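/- Let $M$ be a smooth manifold of any finite dimension $n$ with a smooth pseudo-Riemannian metric $g$ of arbitrary (Lorentzian, Riemannian, or other) signature, and suppose that $(M,g)$ is locally one of the homogeneous model spaces, i.e. has constant curvature: for some $\kappa\in\mathbb R$, $$R(X,Y)Z=\kappa\,\bigl(g(Y,Z)X-g(X,Z)Y\bigr)$$ for all vector fields $X,Y,Z$ (Minkowski, de Sitter and anti-de Sitter spacetime if $g$ is Lorentzian). Let $V$ be a smooth nowhere null vector field (for instance a timelike one), let $u=V/\sqrt{|g(V,V)|}$, and let $\nabla$ be the Levi-Civita connection. For vectors $a,b$ orthogonal to $V$ put $M(a,b)=g(a,\nabla_b u)$; the trace, the traceless symmetric part and the antisymmetric part of $M$ on $V^\perp$ are the expansion, the shear and the rotation of the flow of $V$. Suppose that the flow is Born-rigid, i.e. its shear and its expansion vanish identically. Then the flow is isometric near every point at which its rotation is non-zero: every such point has an open neighbourhood $W$ with a smooth function $f>0$ on $W$ such that $fV$ is a Killing vector field on $W$. In particular, if the rotation vanishes nowhere, then the flow is everywhere locally generated by Killing vector fields. -/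

import Mathlib

open Bundle VectorField
open scoped Manifold ContDiff

noncomputable section

namespace RigidFlow

variable {E : Type*} [NormedAddCommGroup E] [NormedSpace ℝ E]
  {M : Type*} [TopologicalSpace M] [ChartedSpace E M]

/-- A (tangent) vector field on `M`, as a bare function. -/
abbrev VField (E : Type*) [NormedAddCommGroup E] [NormedSpace ℝ E]
    (M : Type*) [TopologicalSpace M] [ChartedSpace E M] : Type _ :=
  Π x : M, TangentSpace 𝓘(ℝ, E) x

/-- A smooth pseudo-Riemannian metric, of arbitrary signature, on a manifold `M` modelled on `E`:
a smooth field of symmetric nondegenerate bilinear forms on the tangent spaces. -/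
structure PseudoRiemannianMetric (E : Type*) [NormedAddCommGroup E] [NormedSpace ℝ E]
    (M : Type*) [TopologicalSpace M] [ChartedSpace E M] [IsManifold 𝓘(ℝ, E) ∞ M] where
  /-- The bilinear form at a point. -/
  form (x : M) : TangentSpace 𝓘(ℝ, E) x →L[ℝ] TangentSpace 𝓘(ℝ, E) x →L[ℝ] ℝ
  symm (x : M) (v w : TangentSpace 𝓘(ℝ, E) x) : form x v w = form x w v
  nondegenerate (x : M) (v : TangentSpace 𝓘(ℝ, E) x) (hv : ∀ w, form x v w = 0) : v = 0
  contMDiff : ContMDiff 𝓘(ℝ, E) (𝓘(ℝ, E).prod 𝓘(ℝ, E →L[ℝ] E →L[ℝ] ℝ)) ∞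
    (fun x ↦ TotalSpace.mk' (E →L[ℝ] E →L[ℝ] ℝ)
      (E := fun x : M ↦ TangentSpace 𝓘(ℝ, E) x →L[ℝ] TangentSpace 𝓘(ℝ, E) x →L[ℝ] ℝ) x (form x))

/-- `X` is of class `C^∞` at `x` (each finite order of smoothness holds near `x`). -/
def SmoothAt (X : VField E M) (x : M) [IsManifold 𝓘(ℝ, E) ∞ M] : Prop :=
  ContMDiffAt 𝓘(ℝ, E) 𝓘(ℝ, E).tangent ∞ (T% X) x

variable [IsManifold 𝓘(ℝ, E) ∞ M] (g : PseudoRiemannianMetric E M)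

/-! ### The Levi-Civita connection -/

lemma mdiffAt_form {Y Z : VField E M} {x : M}
    (hY : MDiffAt (T% Y) x) (hZ : MDiffAt (T% Z) x) :
    MDiffAt (fun y ↦ g.form y (Y y) (Z y)) x := by
  have hg := g.contMDiff.mdifferentiableAt (x := x) (by simp)
  have : MDifferentiableAt 𝓘(ℝ, E) (𝓘(ℝ, E).prod 𝓘(ℝ))
      (fun y ↦ TotalSpace.mk' ℝ (E := Bundle.Trivial M ℝ) y (g.form y (Y y) (Z y))) x :=
    MDifferentiableAt.clm_bundle_apply₂ (F₁ := E) (F₂ := E) hg hY hZ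
  rw [mdifferentiableAt_totalSpace] at this
  exact this.2

/-- The right-hand side of Koszul's formula
`2 g(∇_X Y, Z) = X g(Y,Z) + Y g(Z,X) - Z g(X,Y) + g([X,Y],Z) - g([Y,Z],X) + g([Z,X],Y)`. -/
def koszul (X Y Z : VField E M) (x : M) : ℝ :=
  d% (fun y ↦ g.form y (Y y) (Z y)) x (X x)
  + d% (fun y ↦ g.form y (Z y) (X y)) x (Y x)
  - d% (fun y ↦ g.form y (X y) (Y y)) x (Z x)
  + g.form x (mlieBracket 𝓘(ℝ, E) X Y x) (Z x)
  - g.form x (mlieBracket 𝓘(ℝ, E) Y Z x) (X x)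
  + g.form x (mlieBracket 𝓘(ℝ, E) Z X x) (Y x)

lemma eq_of_form_eq {x : M} {v w : TangentSpace 𝓘(ℝ, E) x}
    (h : ∀ z, g.form x v z = g.form x w z) : v = w := by
  rw [← sub_eq_zero]
  exact g.nondegenerate x _ fun z ↦ by simp [h z]

variable [FiniteDimensional ℝ E]

lemma koszul_tensorial₁ {Y Z : VField E M} {x : M}
    (hY : MDiffAt (T% Y) x) (hZ : MDiffAt (T% Z) x) :
    TensorialAt 𝓘(ℝ, E) E (fun X ↦ koszul g X Y Z x) x where
  smul {f X} hf hX := by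
    have : CompleteSpace E := FiniteDimensional.complete ℝ E
    have h1 := mdiffAt_form g hZ hX
    have h2 := mdiffAt_form g hX hY
    simp only [koszul, Pi.smul_apply', map_smul, smul_apply,
      mlieBracket_smul_left hf hX, mlieBracket_smul_right hf hX, map_add, map_neg,
      add_apply, neg_apply, smul_eq_mul, neg_smul,
      mvfderiv_fun_mul hf h1, mvfderiv_fun_mul hf h2]
    rw [g.symm x (Z x) (X x)]
    ring
  add {X X'} hX hX' := by
    have : CompleteSpace E := FiniteDimensional.complete ℝ E
    simp only [koszul, Pi.add_apply, map_add, add_apply,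
      mlieBracket_add_left hX hX', mlieBracket_add_right hX hX',
      mvfderiv_fun_add (mdiffAt_form g hZ hX) (mdiffAt_form g hZ hX'),
      mvfderiv_fun_add (mdiffAt_form g hX hY) (mdiffAt_form g hX' hY)]
    ring

lemma koszul_tensorial₃ {X Y : VField E M} {x : M}
    (hX : MDiffAt (T% X) x) (hY : MDiffAt (T% Y) x) :
    TensorialAt 𝓘(ℝ, E) E (fun Z ↦ koszul g X Y Z x) x where
  smul {f Z} hf hZ := by
    have : CompleteSpace E := FiniteDimensional.complete ℝ E
    have h1 := mdiffAt_form g hY hZ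
    have h2 := mdiffAt_form g hZ hX
    simp only [koszul, Pi.smul_apply', map_smul, smul_apply,
      mlieBracket_smul_left hf hZ, mlieBracket_smul_right hf hZ, map_add, map_neg,
      add_apply, neg_apply, smul_eq_mul, neg_smul,
      mvfderiv_fun_mul hf h1, mvfderiv_fun_mul hf h2]
    rw [g.symm x (Z x) (X x), g.symm x (Z x) (Y x)]
    ring
  add {Z Z'} hZ hZ' := by
    have : CompleteSpace E := FiniteDimensional.complete ℝ E
    simp only [koszul, Pi.add_apply, map_add, add_apply,
      mlieBracket_add_left hZ hZ', mlieBracket_add_right hZ hZ',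
      mvfderiv_fun_add (mdiffAt_form g hY hZ) (mdiffAt_form g hY hZ'),
      mvfderiv_fun_add (mdiffAt_form g hZ hX) (mdiffAt_form g hZ' hX)]
    ring

lemma koszul_add {X Y Y' Z : VField E M} {x : M} (hX : MDiffAt (T% X) x)
    (hY : MDiffAt (T% Y) x) (hY' : MDiffAt (T% Y') x) (hZ : MDiffAt (T% Z) x) :
    koszul g X (Y + Y') Z x = koszul g X Y Z x + koszul g X Y' Z x := by
  have : CompleteSpace E := FiniteDimensional.complete ℝ E
  simp only [koszul, Pi.add_apply, map_add, add_apply,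
    mlieBracket_add_left hY hY', mlieBracket_add_right hY hY',
    mvfderiv_fun_add (mdiffAt_form g hY hZ) (mdiffAt_form g hY' hZ),
    mvfderiv_fun_add (mdiffAt_form g hX hY) (mdiffAt_form g hX hY')]
  ring

lemma koszul_leibniz {f : M → ℝ} {X Y Z : VField E M} {x : M} (hf : MDiffAt f x)
    (hX : MDiffAt (T% X) x) (hY : MDiffAt (T% Y) x) (hZ : MDiffAt (T% Z) x) :
    koszul g X (f • Y) Z x =
      f x * koszul g X Y Z x + 2 * (d% f x (X x) * g.form x (Y x) (Z x)) := by
  have : CompleteSpace E := FiniteDimensional.complete ℝ E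
  have h1 := mdiffAt_form g hY hZ
  have h2 := mdiffAt_form g hX hY
  simp only [koszul, Pi.smul_apply', map_smul, smul_apply,
    mlieBracket_smul_left hf hY, mlieBracket_smul_right hf hY, map_add, map_neg,
    add_apply, neg_apply, smul_eq_mul, neg_smul,
    mvfderiv_fun_mul hf h1, mvfderiv_fun_mul hf h2]
  rw [g.symm x (X x) (Y x)]
  ring

/-- The metric as an isomorphism from vectors to covectors. -/
def flat (x : M) :
    TangentSpace 𝓘(ℝ, E) x ≃ₗ[ℝ] (TangentSpace 𝓘(ℝ, E) x →L[ℝ] ℝ) :=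
  haveI : FiniteDimensional ℝ (TangentSpace 𝓘(ℝ, E) x) := inferInstanceAs (FiniteDimensional ℝ E)
  haveI : FiniteDimensional ℝ (TangentSpace 𝓘(ℝ, E) x →L[ℝ] ℝ) :=
    inferInstanceAs (FiniteDimensional ℝ (E →L[ℝ] ℝ))
  LinearEquiv.ofInjectiveOfFinrankEq (g.form x : _ →ₗ[ℝ] _)
    ((injective_iff_map_eq_zero _).2 fun v hv ↦
      g.nondegenerate x v fun w ↦ by simpa using congr($hv w))
    (show Module.finrank ℝ E = Module.finrank ℝ (E →L[ℝ] ℝ) by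
      rw [← (LinearMap.toContinuousLinearMap (𝕜 := ℝ) (E := E) (F' := ℝ)).finrank_eq]
      exact Subspace.dual_finrank_eq.symm)

lemma flat_apply (x : M) (v : TangentSpace 𝓘(ℝ, E) x) : flat g x v = g.form x v := by
  rfl

open Classical in
/-- The Levi-Civita connection of `g`, as a bare function: at a point `x` where the field `Y` is
differentiable, `∇_v Y` is the vector with `2 g(∇_v Y, z) = koszul X Y Z x` for all fields `X`, `Z`
differentiable at `x` with `X x = v` and `Z x = z`. -/
def leviCivitaFun (Y : VField E M) (x : M) :
    TangentSpace 𝓘(ℝ, E) x →L[ℝ] TangentSpace 𝓘(ℝ, E) x :=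
  haveI : FiniteDimensional ℝ (TangentSpace 𝓘(ℝ, E) x) := inferInstanceAs (FiniteDimensional ℝ E)
  haveI : T2Space (TangentSpace 𝓘(ℝ, E) x) := inferInstanceAs (T2Space E)
  if hY : MDiffAt (T% Y) x then
    LinearMap.toContinuousLinearMap ((1 / 2 : ℝ) • ((flat g x).symm.toLinearMap ∘ₗ
      (TensorialAt.mkHom₂ (fun X Z ↦ koszul g X Y Z x) x
        (fun _ hZ ↦ koszul_tensorial₁ g hY hZ)
        (fun _ hX ↦ koszul_tensorial₃ g hX hY)).toLinearMap))
  else 0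

lemma form_leviCivitaFun {X Y Z : VField E M} {x : M}
    (hX : MDiffAt (T% X) x) (hY : MDiffAt (T% Y) x) (hZ : MDiffAt (T% Z) x) :
    2 * g.form x (leviCivitaFun g Y x (X x)) (Z x) = koszul g X Y Z x := by
  rw [leviCivitaFun, dif_pos hY, ← flat_apply]
  simp only [LinearMap.coe_toContinuousLinearMap', map_smul,
    LinearMap.comp_apply, LinearEquiv.coe_coe, LinearEquiv.apply_symm_apply, smul_apply,
    smul_eq_mul, ContinuousLinearMap.coe_coe]
  rw [TensorialAt.mkHom₂_apply _ _ hX hZ]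
  ring

/-- To identify `∇_v Y`, it is enough to test it with Koszul's formula. -/
lemma leviCivitaFun_ext {Y : VField E M} {x : M} (hY : MDiffAt (T% Y) x)
    {A : TangentSpace 𝓘(ℝ, E) x →L[ℝ] TangentSpace 𝓘(ℝ, E) x}
    (h : ∀ X Z : VField E M, MDiffAt (T% X) x → MDiffAt (T% Z) x →
      2 * g.form x (A (X x)) (Z x) = koszul g X Y Z x) : leviCivitaFun g Y x = A := by
  ext v
  refine eq_of_form_eq g fun z ↦ ?_
  have hv := FiberBundle.mdifferentiableAt_extend 𝓘(ℝ, E) E v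
  have hz := FiberBundle.mdifferentiableAt_extend 𝓘(ℝ, E) E z
  have h1 := form_leviCivitaFun g hv hY hz
  rw [← h _ _ hv hz] at h1
  simpa using h1

/-- The Levi-Civita connection of `g`; `leviCivita g Y x v` is `∇_v Y` at `x`. -/
def leviCivita : CovariantDerivative 𝓘(ℝ, E) E (TangentSpace 𝓘(ℝ, E) : M → Type _) where
  toFun := leviCivitaFun g
  isCovariantDerivativeOnUniv :=
    { add := by
        intro Y Y' x hY hY' _
        refine leviCivitaFun_ext g (mdifferentiableAt_add_section hY hY') fun X Z hX hZ ↦ ?_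
        rw [koszul_add g hX hY hY' hZ, ← form_leviCivitaFun g hX hY hZ,
          ← form_leviCivitaFun g hX hY' hZ]
        simp only [add_apply, map_add]
        ring
      leibniz := by
        intro Y f x hY hf _
        refine leviCivitaFun_ext g (hf.smul_section hY) fun X Z hX hZ ↦ ?_
        rw [koszul_leibniz g hf hX hY hZ, ← form_leviCivitaFun g hX hY hZ]
        simp only [add_apply, map_add, smul_apply, map_smul, smul_eq_mul,
          ContinuousLinearMap.smulRight_apply]
        ring }

theorem leviCivita_torsionFree {X Y : VField E M} {x : M}
    (hX : MDiffAt (T% X) x) (hY : MDiffAt (T% Y) x) :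
    leviCivita g Y x (X x) - leviCivita g X x (Y x) = mlieBracket 𝓘(ℝ, E) X Y x := by
  refine eq_of_form_eq g fun z ↦ ?_
  have hz := FiberBundle.mdifferentiableAt_extend 𝓘(ℝ, E) E z
  have h1 := form_leviCivitaFun g hX hY hz
  have h2 := form_leviCivitaFun g hY hX hz
  rw [koszul] at h1 h2
  rw [mlieBracket_swap_apply (V := Y) (W := X)] at h2
  rw [mlieBracket_swap_apply (W := Y) (V := FiberBundle.extend E z)] at h2
  rw [mlieBracket_swap_apply (V := X) (W := FiberBundle.extend E z)] at h2
  simp only [FiberBundle.extend_apply_self, map_neg, neg_apply, g.symm _ (X _) (Y _),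
    g.symm _ (FiberBundle.extend E z _) _] at h1 h2
  simp only [map_sub, sub_apply]
  change g.form x (leviCivitaFun g Y x (X x)) z - g.form x (leviCivitaFun g X x (Y x)) z = _
  linarith

theorem leviCivita_metric {Y Z : VField E M} {x : M}
    (hY : MDiffAt (T% Y) x) (hZ : MDiffAt (T% Z) x) (v : TangentSpace 𝓘(ℝ, E) x) :
    d% (fun y ↦ g.form y (Y y) (Z y)) x v =
      g.form x (leviCivita g Y x v) (Z x) + g.form x (Y x) (leviCivita g Z x v) := by
  have hv := FiberBundle.mdifferentiableAt_extend 𝓘(ℝ, E) E v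
  have h1 := form_leviCivitaFun g hv hY hZ
  have h2 := form_leviCivitaFun g hv hZ hY
  rw [koszul] at h1 h2
  rw [mlieBracket_swap_apply (V := Z) (W := Y)] at h2
  rw [mlieBracket_swap_apply (W := Z) (V := FiberBundle.extend E v)] at h2
  rw [mlieBracket_swap_apply (V := Y) (W := FiberBundle.extend E v)] at h2
  simp only [FiberBundle.extend_apply_self, map_neg, neg_apply, g.symm _ (Z _) (Y _),
    g.symm _ (FiberBundle.extend E v _) _] at h1 h2
  rw [g.symm x (Y x)]
  change _ = g.form x (leviCivitaFun g Y x v) (Z x) + g.form x (leviCivitaFun g Z x v) (Y x)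
  linarith

/-! ### Homogeneous spacetimes -/

/-- The Riemann curvature `R(X, Y) Z = ∇_X ∇_Y Z - ∇_Y ∇_X Z - ∇_{[X, Y]} Z`. -/
def curvature (X Y Z : VField E M) (x : M) : TangentSpace 𝓘(ℝ, E) x :=
  leviCivita g (fun y ↦ leviCivita g Z y (Y y)) x (X x)
    - leviCivita g (fun y ↦ leviCivita g Z y (X y)) x (Y x)
    - leviCivita g Z x (mlieBracket 𝓘(ℝ, E) X Y x)

/-- Homogeneous spacetime: `g` is locally one of the homogeneous model geometries (flat, de Sitter
or anti-de Sitter; Euclidean, spherical or hyperbolic; and their analogues in any signature), that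
is, `Ω^μ_ν = -κ ω^μ ∧ ω_ν` up to sign convention, with one constant `κ`:
`R(X, Y) Z = κ (g(Y, Z) X - g(X, Z) Y)`. -/
def HasConstantCurvature : Prop :=
  ∃ κ : ℝ, ∀ (x : M) (X Y Z : VField E M), SmoothAt X x → SmoothAt Y x → SmoothAt Z x →
    curvature g X Y Z x = κ • (g.form x (Y x) (Z x) • X x - g.form x (X x) (Z x) • Y x)

/-! ### Kinematics of a flow -/

/-- `V` is nowhere null; every timelike vector field is. -/
def IsNonNull (V : VField E M) : Prop :=
  ∀ x, g.form x (V x) (V x) ≠ 0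

/-- The unit field along the flow of a nowhere null field `V`. -/
def unitField (V : VField E M) : VField E M :=
  fun x ↦ (√|g.form x (V x) (V x)|)⁻¹ • V x

/-- The orthogonal projection onto the orthogonal complement of the flow direction. -/
def proj (V : VField E M) (x : M) :
    TangentSpace 𝓘(ℝ, E) x →L[ℝ] TangentSpace 𝓘(ℝ, E) x :=
  ContinuousLinearMap.id ℝ _ - ((g.form x (V x) (V x))⁻¹ • g.form x (V x)).smulRight (V x)

/-- The covariant derivative of the unit field, restricted and projected to the orthogonal
complement of the flow (and extended by zero along the flow). -/
def flowGradient (V : VField E M) (x : M) :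
    TangentSpace 𝓘(ℝ, E) x →L[ℝ] TangentSpace 𝓘(ℝ, E) x :=
  proj g V x ∘L leviCivita g (unitField g V) x ∘L proj g V x

/-- The tensor `M_{ij}` of the flow, `M(a, b) = g(a, ∇_b u)` on the orthogonal complement. -/
def kinematic (V : VField E M) (x : M) (a b : TangentSpace 𝓘(ℝ, E) x) : ℝ :=
  g.form x a (flowGradient g V x b)

/-- The rotation (angular velocity): the antisymmetric part of `M_{ij}`. -/
def rotation (V : VField E M) (x : M) (a b : TangentSpace 𝓘(ℝ, E) x) : ℝ :=
  (kinematic g V x a b - kinematic g V x b a) / 2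

/-- The expansion: the trace of `M_{ij}`. -/
def expansion (V : VField E M) (x : M) : ℝ :=
  LinearMap.trace ℝ (TangentSpace 𝓘(ℝ, E) x) (flowGradient g V x).toLinearMap

/-- The shear: the traceless symmetric part of `M_{ij}`. -/
def shear (V : VField E M) (x : M) (a b : TangentSpace 𝓘(ℝ, E) x) : ℝ :=
  (kinematic g V x a b + kinematic g V x b a) / 2
    - expansion g V x / ((Module.finrank ℝ E : ℝ) - 1) * g.form x (proj g V x a) (proj g V x b)

/-- Born rigidity: the flow of `V` is free of shear and of expansion. -/
def IsBornRigid (V : VField E M) : Prop :=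
  ∀ x, expansion g V x = 0 ∧ ∀ a b, shear g V x a b = 0

/-- The flow of `V` is rotating at `x`: `M_{ij}` has a nonzero antisymmetric part there. -/
def IsRotatingAt (V : VField E M) (x : M) : Prop :=
  ∃ a b, rotation g V x a b ≠ 0

/-! ### Isometric flows -/

/-- `ξ` is a Killing field on `W`: the Lie derivative
`(L_ξ g)(X, Y) = ξ (g(X, Y)) - g([ξ, X], Y) - g(X, [ξ, Y])` of the metric vanishes on `W`. -/
def IsKillingOn (ξ : VField E M) (W : Set M) : Prop :=
  ∀ x ∈ W, ∀ X Y : VField E M, SmoothAt X x → SmoothAt Y x →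
    d% (fun y ↦ g.form y (X y) (Y y)) x (ξ x)
      - g.form x (mlieBracket 𝓘(ℝ, E) ξ X x) (Y x)
      - g.form x (X x) (mlieBracket 𝓘(ℝ, E) ξ Y x) = 0

/-- The flow of `V` is isometric near `p`: on a neighbourhood of `p`, its flow lines are the
integral curves of a smooth Killing field `f V` with `f > 0`. -/
def IsIsometricNear (V : VField E M) (p : M) : Prop :=
  ∃ (W : Set M) (f : M → ℝ), IsOpen W ∧ p ∈ W ∧ (∀ x ∈ W, 0 < f x) ∧
    ContMDiffOn 𝓘(ℝ, E) 𝓘(ℝ, ℝ) ∞ f W ∧ IsKillingOn g (fun x ↦ f x • V x) W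

end RigidFlow

end

/-! Let `ε = g(u, u) = ±1` and let `a = ∇_u u` be the acceleration. Without shear and expansion,
`∇_X u = Ω X + ε g(u, X) a`, where `Ω` is skew and kills `u`. Hence the symmetric part of `∇u` is
the symmetrized product of `u♭` and `ε a♭`. If `ε a♭ = dψ`, the derivative of the factor in `exp(-ψ)
u` cancels exactly this term, and `exp(-ψ) u` is Killing. By the Poincaré lemma it remains to see
that `a♭` is closed, i.e. that `C(X, Y) = g(∇_X a, Y)` is symmetric.

Closedness is an integrability condition. Let `F(X, Y) = g(Ω X, Y)` be the rotation, `T = ∇F`, and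
`P`, `Q` orthogonal to `u`. The curvature identity applied to `u` is a Codazzi equation, which
expresses the antisymmetrization of `T` in its first two slots through `F`, `a` and `C`; as `T` is
skew in the last two, this controls `T`. Inserted into the Ricci identity for `∇∇F` at `(P, Q, P,
Q)`, it yields `3 ε F(P, Q) (C(P, Q) - C(Q, P)) = 0`: in constant curvature all terms in `κ` cancel
(`F_mul_C_sub`). Polarization (`bilin_eq_zero_of_mul_eq_zero`) then makes `C` symmetric on `u^⊥`
where `F` is non-zero. This forces `∇_u F = 0` on `u^⊥`, and the Ricci identity at `(u, P, P, Q)`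
gives the mixed components in the same way (`F_mul_C_u_sub`, `C_symm`).

The computation is pure algebra over a commutative ring without additive torsion. It is applied to
smooth functions and fields on an open set where some `F(X₀, Y₀)` vanishes nowhere, so that this
function can be cancelled. -/

namespace RigidFlow

/-! ### Polarization of a product of two bilinear forms -/

section Algebra

variable {A L : Type*} [CommRing A] [IsAddTorsionFree A] [AddCommGroup L]

lemma eq_zero_of_two_mul {a : A} (h : 2 * a = 0) : a = 0 := by
  have : (2 : ℕ) • a = (2 : ℕ) • 0 := by rw [nsmul_zero, ← h, nsmul_eq_mul, Nat.cast_ofNat]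
  exact nsmul_right_injective two_ne_zero this

/-- Polarization around `(X₀, Y₀)`: replacing `X₀` by `X₀ ± X` and `Y₀` by `Y₀ ± Y` and combining
the signs isolates `f X₀ Y₀ * q X Y`, up to a power of 2. Only the one value `f X₀ Y₀` has to be
cancellable; the ring may have zero divisors. -/
lemma bilin_eq_zero_of_mul_eq_zero (f q : L → L → A) (hf : ∀ X Y Z, f (X + Y) Z = f X Z + f Y Z)
    (hf' : ∀ X Y Z, f X (Y + Z) = f X Y + f X Z) (hq : ∀ X Y Z, q (X + Y) Z = q X Z + q Y Z)
    (hq' : ∀ X Y Z, q X (Y + Z) = q X Y + q X Z) (H : AddSubgroup L)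
    (h : ∀ X ∈ H, ∀ Y ∈ H, f X Y * q X Y = 0) {X₀ Y₀ : L} (hX₀ : X₀ ∈ H) (hY₀ : Y₀ ∈ H)
    (hreg : ∀ a, f X₀ Y₀ * a = 0 → a = 0) : ∀ X ∈ H, ∀ Y ∈ H, q X Y = 0 := by
  have hfn (X Y) : f (-X) Y = -f X Y := (AddMonoidHom.mk' (f · Y) fun _ _ ↦ hf _ _ _).map_neg X
  have hfn' (X Y) : f X (-Y) = -f X Y := (AddMonoidHom.mk' (f X) fun _ _ ↦ hf' _ _ _).map_neg Y
  have hqn (X Y) : q (-X) Y = -q X Y := (AddMonoidHom.mk' (q · Y) fun _ _ ↦ hq _ _ _).map_neg X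
  have hqn' (X Y) : q X (-Y) = -q X Y := (AddMonoidHom.mk' (q X) fun _ _ ↦ hq' _ _ _).map_neg Y
  have h0 : q X₀ Y₀ = 0 := hreg _ (h _ hX₀ _ hY₀)
  have h1 X (hX : X ∈ H) : q X Y₀ = 0 := by
    have e1 := h _ (H.add_mem hX₀ hX) _ hY₀
    have e2 := h _ (H.add_mem hX₀ (H.neg_mem hX)) _ hY₀
    rw [hf, hq, h0] at e1 e2
    rw [hfn, hqn] at e2
    exact hreg _ (eq_zero_of_two_mul (by linear_combination e1 - e2))
  have h2 Y (hY : Y ∈ H) : q X₀ Y = 0 := by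
    have e1 := h _ hX₀ _ (H.add_mem hY₀ hY)
    have e2 := h _ hX₀ _ (H.add_mem hY₀ (H.neg_mem hY))
    rw [hf', hq', h0] at e1 e2
    rw [hfn', hqn'] at e2
    exact hreg _ (eq_zero_of_two_mul (by linear_combination e1 - e2))
  intro X hX Y hY
  have key {X Y} (hX : X ∈ H) (hY : Y ∈ H) : (f X₀ Y₀ + f X Y₀ + f X₀ Y + f X Y) * q X Y = 0 := by
    have := h _ (H.add_mem hX₀ hX) _ (H.add_mem hY₀ hY)
    rw [hf, hf', hf', hq, hq', hq', h0, h1 X hX, h2 Y hY] at this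
    linear_combination this
  have e1 := key hX hY
  have e2 := key (H.neg_mem hX) hY
  have e3 := key hX (H.neg_mem hY)
  have e4 := key (H.neg_mem hX) (H.neg_mem hY)
  simp only [hfn, hfn', hqn, hqn'] at e2 e3 e4
  -- The alternating sum over the four sign choices is `4 * f X₀ Y₀ * q X Y`.
  exact hreg _ (eq_zero_of_two_mul (eq_zero_of_two_mul (by linear_combination e1 - e2 - e3 + e4)))

end Algebra

/-- The algebra of vector fields (the module `L`) and functions (the ring `A`) on a
pseudo-Riemannian manifold of constant curvature `κ`, with its Levi-Civita connection. -/
structure ConstCurvModule (A L : Type*) [CommRing A] [AddCommGroup L] [Module A L] where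
  /-- The metric. -/
  g : L →ₗ[A] L →ₗ[A] A
  symm (X Y : L) : g X Y = g Y X
  /-- The derivative of a function along a vector field. -/
  der : L → A → A
  der_add (X : L) (a b : A) : der X (a + b) = der X a + der X b
  der_mul (X : L) (a b : A) : der X (a * b) = a * der X b + b * der X a
  /-- The covariant derivative, `nab X Y = ∇_X Y`. -/
  nab : L →+ L →+ L
  nab_smul_left (a : A) (X Y : L) : nab (a • X) Y = a • nab X Y
  nab_smul_right (a : A) (X Y : L) : nab X (a • Y) = a • nab X Y + der X a • Y
  metric (X Y Z : L) : der X (g Y Z) = g (nab X Y) Z + g Y (nab X Z)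
  /-- The curvature constant. -/
  κ : A
  curv (X Y Z : L) : nab X (nab Y Z) - nab Y (nab X Z) - nab (nab X Y - nab Y X) Z =
    κ • (g Y Z • X - g X Z • Y)

/-- A unit field `u` whose flow has neither shear nor expansion. -/
structure RigidUnitField (A L : Type*) [CommRing A] [AddCommGroup L] [Module A L] extends
    ConstCurvModule A L where
  /-- The unit field. -/
  u : L
  unit : g u u * g u u = 1
  rigid (X Y : L) : g u X = 0 → g u Y = 0 → g (nab X u) Y + g (nab Y u) X = 0

/-! ### Structure equations of a rigid unit field -/

namespace RigidUnitField

variable {A L : Type*} [CommRing A] [AddCommGroup L] [Module A L] (S : RigidUnitField A L)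

/-- The norm `g(u, u) = ±1`. -/
def ε : A := S.g S.u S.u

/-- The acceleration `∇_u u`. -/
def acc : L := S.nab S.u S.u

/-- The spatial part of `X ↦ ∇_X u`. -/
def Ω : L →ₗ[A] L where
  toFun X := S.nab X S.u - (S.ε * S.g S.u X) • S.acc
  map_add' X Y := by
    simp only [map_add, AddMonoidHom.add_apply]
    module
  map_smul' a X := by
    simp only [S.nab_smul_left, map_smul, smul_eq_mul, RingHom.id_apply]
    module

lemma Ω_apply (X : L) : S.Ω X = S.nab X S.u - (S.ε * S.g S.u X) • S.acc := rfl

lemma nab_u (X : L) : S.nab X S.u = S.Ω X + (S.ε * S.g S.u X) • S.acc := by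
  rw [Ω_apply]; abel

lemma nab_u_spatial {X : L} (hX : S.g S.u X = 0) : S.nab X S.u = S.Ω X := by
  rw [nab_u, hX, mul_zero, zero_smul, add_zero]

lemma ε_mul_ε : S.ε * S.ε = 1 := S.unit

lemma g_u_u : S.g S.u S.u = S.ε := rfl

lemma der_one (X : L) : S.der X 1 = 0 := by
  have := S.der_mul X 1 1
  simp only [mul_one, one_mul] at this
  simpa using this

lemma der_zero (X : L) : S.der X 0 = 0 := by
  simpa using S.der_add X 0 0

lemma der_neg (X : L) (a : A) : S.der X (-a) = -S.der X a := by
  have := S.der_add X a (-a)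
  rw [add_neg_cancel, der_zero] at this
  linear_combination -this

/-- The covariant derivative of `Ω`. -/
def dΩ (X Y : L) : L := S.nab X (S.Ω Y) - S.Ω (S.nab X Y)

/-- The acceleration covector. -/
def α (X : L) : A := S.g S.acc X

/-- The covariant derivative of the acceleration. -/
def C (X Y : L) : A := S.g (S.nab X S.acc) Y

/-- The rotation as a bilinear form. -/
def F (X Y : L) : A := S.g (S.Ω X) Y

/-- The covariant derivative of the rotation. -/
def T (X Y Z : L) : A := S.g (S.dΩ X Y) Z

lemma Ω_u : S.Ω S.u = 0 := by
  rw [Ω_apply]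
  change S.acc - (S.ε * S.ε) • S.acc = 0
  rw [S.ε_mul_ε, one_smul, sub_self]

lemma g_nab_u (X Y : L) : S.g (S.nab X S.u) Y = S.F X Y + S.ε * S.g S.u X * S.α Y := by
  rw [nab_u]; simp [F, α]

lemma der_F (X Y Z : L) :
    S.der X (S.F Y Z) = S.T X Y Z + S.F (S.nab X Y) Z + S.F Y (S.nab X Z) := by
  rw [F, S.metric, T, dΩ]
  simp [F]

lemma der_α (X Y : L) : S.der X (S.α Y) = S.C X Y + S.α (S.nab X Y) := S.metric _ _ _

/-- The antisymmetrized second covariant derivative of an endomorphism is its commutator with the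
curvature, here `R(W, X) Ω Y - Ω R(W, X) Y`. Torsion-freeness is built in, since `curv` uses `∇_X Y
- ∇_Y X` as the bracket. -/
lemma ricci_vector (W X Y : L) :
    S.nab W (S.dΩ X Y) - S.dΩ (S.nab W X) Y - S.dΩ X (S.nab W Y)
      - (S.nab X (S.dΩ W Y) - S.dΩ (S.nab X W) Y - S.dΩ W (S.nab X Y)) =
    S.κ • (S.g X (S.Ω Y) • W - S.g W (S.Ω Y) • X) - S.Ω (S.κ • (S.g X Y • W - S.g W Y • X)) := by
  rw [← S.curv, ← S.curv]
  simp only [dΩ, map_sub, AddMonoidHom.sub_apply]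
  abel

/-- `g(u, ∇_X Y)` for `Y` orthogonal to `u`. -/
lemma g_u_nab (X Y : L) (hY : S.g S.u Y = 0) :
    S.g S.u (S.nab X Y) = -(S.F X Y + S.ε * S.g S.u X * S.α Y) := by
  have := S.metric X S.u Y
  rw [hY, der_zero, g_nab_u] at this
  linear_combination -this

/-- The Ricci identity for the rotation. -/
lemma ricci (W X Y Z : L) :
    (S.der W (S.T X Y Z) - S.T (S.nab W X) Y Z - S.T X (S.nab W Y) Z - S.T X Y (S.nab W Z))
      - (S.der X (S.T W Y Z) - S.T (S.nab X W) Y Z - S.T W (S.nab X Y) Z - S.T W Y (S.nab X Z)) =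
    S.κ * (S.F Y X * S.g W Z - S.F Y W * S.g X Z - S.g X Y * S.F W Z + S.g W Y * S.F X Z) := by
  have h := congr(S.g $(S.ricci_vector W X Y) Z)
  simp only [map_sub, map_smul, LinearMap.sub_apply,
    LinearMap.smul_apply, smul_eq_mul, S.symm _ (S.Ω _)] at h
  simp only [T, F, S.metric]
  linear_combination h

section torsionfree

variable [IsAddTorsionFree A]

lemma der_ε (X : L) : S.der X S.ε = 0 := by
  have h := S.der_mul X S.ε S.ε
  rw [S.ε_mul_ε, der_one] at h
  have h2 : S.ε * S.der X S.ε = 0 := eq_zero_of_two_mul (by linear_combination -h)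
  linear_combination S.ε * h2 - S.der X S.ε * S.ε_mul_ε

lemma g_nab_u_u (X : L) : S.g (S.nab X S.u) S.u = 0 := by
  have h := S.metric X S.u S.u
  rw [S.symm S.u (S.nab X S.u)] at h
  have h0 := S.der_ε X
  rw [ε, h] at h0
  exact eq_zero_of_two_mul (by linear_combination h0)

lemma α_u : S.α S.u = 0 := S.g_nab_u_u _

lemma F_u (X : L) : S.F X S.u = 0 := by
  have := S.g_nab_u_u X
  rw [nab_u] at this
  simp only [map_add, map_smul, LinearMap.add_apply, LinearMap.smul_apply] at this
  have h2 := S.α_u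
  rw [α] at h2
  simpa [h2, F] using this

/-- Rigidity gives skewness for arguments orthogonal to `u`. Since `F` vanishes when either argument
is `u`, projecting both arguments orthogonally to `u` does not change it. -/
lemma F_skew (X Y : L) : S.F X Y = -S.F Y X := by
  have key (X Y : L) (hX : S.g S.u X = 0) (hY : S.g S.u Y = 0) : S.F X Y + S.F Y X = 0 := by
    have := S.rigid X Y hX hY
    rw [nab_u, nab_u, hX, hY] at this
    simpa [F] using this
  have hp (X : L) : S.g S.u (X - (S.ε * S.g S.u X) • S.u) = 0 := by
    simp only [map_sub, map_smul, smul_eq_mul]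
    change _ - S.ε * _ * S.ε = 0
    linear_combination -S.g S.u X * S.ε_mul_ε
  have := key _ _ (hp X) (hp Y)
  simp only [F, map_sub, map_smul, Ω_u, smul_zero, sub_zero] at this
  have h1 := S.F_u X
  have h2 := S.F_u Y
  simp only [F] at h1 h2
  simp only [h1, h2, smul_zero, sub_zero] at this
  exact eq_neg_of_add_eq_zero_left this

lemma F_u_left (X : L) : S.F S.u X = 0 := by rw [F_skew, F_u, neg_zero]

lemma g_u_Ω (X : L) : S.g S.u (S.Ω X) = 0 := by
  rw [S.symm]; exact S.F_u X

lemma T_skew (X Y Z : L) : S.T X Y Z = -S.T X Z Y := by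
  have h1 := S.der_F X Y Z
  have h2 := S.der_F X Z Y
  rw [S.F_skew Y Z, der_neg, h2] at h1
  rw [S.F_skew (S.nab X Y) Z, S.F_skew Y] at h1
  linear_combination -h1

lemma T_self (X Y : L) : S.T X Y Y = 0 :=
  eq_zero_of_two_mul (by linear_combination S.T_skew X Y Y)

lemma F_self (X : L) : S.F X X = 0 :=
  eq_zero_of_two_mul (by linear_combination S.F_skew X X)

/-- The Codazzi equation. -/
lemma codazzi_vector (X Y : L) : S.dΩ X Y - S.dΩ Y X =
    S.κ • (S.g S.u Y • X - S.g S.u X • Y) - S.ε • ((S.g (S.nab X S.u) Y - S.g (S.nab Y S.u) X) • S.acc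
      + S.g S.u Y • S.nab X S.acc - S.g S.u X • S.nab Y S.acc) := by
  -- Curvature acting on `u`, with every `∇u` split into `Ω` and the acceleration term.
  have h := S.curv X Y S.u
  rw [S.symm Y, S.symm X, S.nab_u Y, S.nab_u X, S.nab_u (_ - _)] at h
  simp only [map_add, map_sub, S.nab_smul_right, S.der_mul, S.der_ε, S.metric] at h
  rw [← sub_eq_zero] at h ⊢
  rw [← h]
  simp only [dΩ]
  module

lemma codazzi (X Y Z : L) : S.T X Y Z - S.T Y X Z =
    S.κ * (S.g S.u Y * S.g X Z - S.g S.u X * S.g Y Z) -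
      S.ε * ((2 * S.F X Y + S.ε * (S.g S.u X * S.α Y - S.g S.u Y * S.α X)) * S.α Z
        + S.g S.u Y * S.C X Z - S.g S.u X * S.C Y Z) := by
  have h := congr(S.g $(S.codazzi_vector X Y) Z)
  simp only [map_add, map_sub, map_smul, LinearMap.add_apply, LinearMap.sub_apply,
    LinearMap.smul_apply, smul_eq_mul, g_nab_u] at h
  rw [S.F_skew Y X] at h
  simp only [T, C, α] at h ⊢
  linear_combination h

/-- The inserted terms `T Y X Z` and `T Y Z X` cancel by skewness. A sum symmetric in the outer
slots is thus a sum of two Codazzi differences, computable even when an argument such as `∇_P Q` is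
not orthogonal to `u`. -/
lemma T_add_T (X Y Z : L) : S.T X Y Z + S.T Z Y X =
    (S.T X Y Z - S.T Y X Z) + (S.T Z Y X - S.T Y Z X) := by
  linear_combination S.T_skew Y X Z

/-! ### Closedness of the acceleration of a rotating rigid flow -/

variable {S}

/-- The Ricci identity at `(P, Q, P, Q)`. Its left side is a sum of two expressions exchanged by `P
↔ Q`, each computed in `half`; the terms in `κ` and in `α P * α Q` are odd under this exchange and
drop out. -/
lemma F_mul_C_sub {P Q : L} (hP : S.g S.u P = 0) (hQ : S.g S.u Q = 0) :
    S.F P Q * (S.C P Q - S.C Q P) = 0 := by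
  have T1 {P Q : L} (hP : S.g S.u P = 0) (hQ : S.g S.u Q = 0) :
      S.T Q P Q = 2 * (S.ε * (S.F P Q * S.α Q)) := by
    have := S.codazzi Q P Q
    rw [S.T_self, hP, hQ, S.F_skew Q P] at this
    linear_combination this
  -- This is `(∇_P T)(Q, P, Q)`. The value of `T Q P Q` may be differentiated, while the correction
  -- terms involve `∇_P P` and `∇_P Q`, whose `u`-components bring in `C` and `κ` through Codazzi.
  have half {P Q : L} (hP : S.g S.u P = 0) (hQ : S.g S.u Q = 0) :
      S.der P (S.T Q P Q) - S.T (S.nab P Q) P Q - S.T Q (S.nab P P) Q - S.T Q P (S.nab P Q) =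
      3 * (S.F P Q * (S.ε * S.C P Q + S.α P * S.α Q)) - S.κ * (S.F P Q * S.g P Q) := by
    have h1 : S.der P (S.T Q P Q) = 2 * (S.ε * (S.F P Q * (S.C P Q + S.α (S.nab P Q)) +
        S.α Q * (S.T P P Q + S.F (S.nab P P) Q + S.F P (S.nab P Q)))) := by
      rw [T1 hP hQ, two_mul, S.der_add, S.der_mul, S.der_mul, S.der_α, S.der_F, S.der_ε]
      ring
    have h2 := S.T_add_T (S.nab P Q) P Q
    rw [S.codazzi, S.codazzi] at h2
    have h3 := S.codazzi Q (S.nab P P) Q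
    rw [S.T_self] at h3
    have h4 := T1 hQ hP
    have h5 := S.T_skew P P Q
    rw [hP, hQ, S.g_u_nab P Q hQ, hP] at h2
    rw [hQ, S.g_u_nab P P hP, hP, S.F_self] at h3
    rw [h5, h4, S.F_skew Q P] at h1
    rw [S.F_skew Q P, S.F_skew (S.nab P Q) P] at h2
    rw [S.F_skew Q (S.nab P P)] at h3
    linear_combination h1 - h2 - h3 + 3 * S.F P Q * S.α P * S.α Q * S.ε_mul_ε
  have h := S.ricci P Q P Q
  have e1 := half hP hQ
  have e2 := half hQ hP
  have e3 := S.T_skew P Q P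
  have s1 := S.T_skew (S.nab Q P) P Q
  have s2 := S.T_skew P (S.nab Q P) Q
  have s3 := S.T_skew P P (S.nab Q Q)
  have s4 := S.T_skew P P Q
  rw [s4, der_neg, s1, S.T_skew P (S.nab Q P) Q, s3, e1, S.F_self, S.F_self, S.symm Q P] at h
  rw [S.F_skew Q P, S.symm Q P] at e2
  have h3 : 3 * (S.ε * (S.F P Q * (S.C P Q - S.C Q P))) = 0 := by
    linear_combination h - e2
  have h4 : (3 : ℕ) • (S.ε * (S.F P Q * (S.C P Q - S.C Q P))) = (3 : ℕ) • 0 := by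
    rw [nsmul_zero, ← h3, nsmul_eq_mul, Nat.cast_ofNat]
  have h5 := nsmul_right_injective three_ne_zero h4
  linear_combination S.ε * h5 - S.F P Q * (S.C P Q - S.C Q P) * S.ε_mul_ε

/-- The derivative of the rotation in spatial directions. -/
lemma T_spatial {P Q R : L} (hP : S.g S.u P = 0) (hQ : S.g S.u Q = 0) (hR : S.g S.u R = 0) :
    S.T P Q R = S.ε * (S.F Q R * S.α P - S.F P Q * S.α R - S.F R P * S.α Q) := by
  have h1 := S.codazzi P Q R
  have h2 := S.codazzi Q R P
  have h3 := S.codazzi R P Q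
  rw [hP, hQ] at h1
  rw [hQ, hR] at h2
  rw [hR, hP] at h3
  rw [← sub_eq_zero]
  refine eq_zero_of_two_mul ?_
  -- As for the Christoffel symbols: skewness in the last two slots and the three cyclic Codazzi
  -- equations determine `T`.
  linear_combination h1 - h2 + h3 + S.T_skew P Q R + S.T_skew Q P R - S.T_skew R P Q

/-- Codazzi at `(u, P)`, with `T P u Q` found by differentiating `F u Q = 0` along `P`. All terms on
the right except `C P Q` are symmetric in `P`, `Q`, while the left side is skew when both are
orthogonal to `u`. -/
lemma T_u_spatial {P Q : L} (hP : S.g S.u P = 0) :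
    S.T S.u P Q = S.C P Q + S.g (S.Ω P) (S.Ω Q) - S.ε * S.κ * S.g P Q - S.ε * S.α P * S.α Q := by
  have h1 := S.codazzi S.u P Q
  have h2 := S.der_F P S.u Q
  rw [F_u_left, F_u_left, der_zero, S.nab_u_spatial hP, S.F_skew, F, S.symm (S.Ω Q)] at h2
  rw [hP, F_u_left, S.g_u_u] at h1
  linear_combination h1 - h2 + (S.C P Q - S.ε * S.α P * S.α Q) * S.ε_mul_ε

/-- If the acceleration is closed in spatial directions, then the rotation does not change along
the flow. -/
lemma T_u_eq_zero (hC : ∀ P Q, S.g S.u P = 0 → S.g S.u Q = 0 → S.C P Q = S.C Q P) {P Q : L}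
    (hP : S.g S.u P = 0) (hQ : S.g S.u Q = 0) : S.T S.u P Q = 0 := by
  have h1 := T_u_spatial (Q := Q) hP
  have h2 := T_u_spatial (Q := P) hQ
  rw [S.symm Q, S.symm (S.Ω Q), hC Q P hQ hP, S.T_skew] at h2
  exact eq_zero_of_two_mul (by linear_combination h1 - h2)

/-- The Ricci identity at `(u, P, P, Q)`. The vanishing of `T u` on `u^⊥` enters twice: it
simplifies the left side, and through `T_u_spatial` it eliminates `C Q P` and `C P P`. -/
lemma F_mul_C_u_sub (hC : ∀ P Q, S.g S.u P = 0 → S.g S.u Q = 0 → S.C P Q = S.C Q P) {P Q : L}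
    (hP : S.g S.u P = 0) (hQ : S.g S.u Q = 0) :
    S.F P Q * (S.C S.u P - S.C P S.u) = 0 := by
  -- Differentiate `α u = 0` along `P`.
  have hCu : S.C P S.u = -S.α (S.Ω P) := by
    have := S.metric P S.acc S.u
    change S.der P (S.α S.u) = S.C P S.u + S.α _ at this
    rw [α_u, der_zero, S.nab_u_spatial hP] at this
    linear_combination -this
  have hT {P Q : L} (hP : S.g S.u P = 0) (hQ : S.g S.u Q = 0) :
      S.T P P Q = 2 * (S.ε * (S.F P Q * S.α P)) := by
    rw [T_spatial hP hP hQ, S.F_self, S.F_skew Q P]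
    ring
  have h1 : S.der S.u (S.T P P Q) = 2 * (S.ε * (S.F P Q * (S.C S.u P + S.α (S.nab S.u P)) +
      S.α P * (S.F (S.nab S.u P) Q + S.F P (S.nab S.u Q)))) := by
    rw [hT hP hQ, two_mul, S.der_add, S.der_mul, S.der_mul, S.der_α, S.der_F, S.der_ε,
      T_u_eq_zero hC hP hQ]
    ring
  have hu {P : L} (hP : S.g S.u P = 0) : S.g S.u (S.nab S.u P) = -S.α P := by
    rw [S.g_u_nab S.u P hP, F_u_left, S.g_u_u]
    linear_combination -S.α P * S.ε_mul_ε
  have h2 := S.T_add_T (S.nab S.u P) Q P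
  rw [S.codazzi, S.codazzi, hP, hQ, hu hP] at h2
  have h3 := S.codazzi (S.nab S.u Q) P P
  rw [S.T_self, hP, hu hQ] at h3
  have h4 := T_spatial (S := S) (S.g_u_Ω P) hP hQ
  have h5 : S.T S.u (S.nab P P) Q = 0 := T_u_eq_zero hC (by
    rw [S.g_u_nab P P hP, S.F_self, hP]; ring) hQ
  -- Adding `ε F(P, Q) u` makes `∇_P Q` orthogonal to `u`, where `T u P` vanishes. The compensating
  -- term `T u P u` comes from differentiating `F u P = 0` along `u`.
  have h6 : S.T S.u P (S.nab P Q) = S.ε * S.F P Q * S.α (S.Ω P) := by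
    have hQ' := S.g_u_nab P Q hQ
    rw [hP] at hQ'
    have h7 : S.T S.u P (S.nab P Q + (S.ε * S.F P Q) • S.u) = 0 := by
      refine T_u_eq_zero hC hP ?_
      rw [map_add, map_smul, hQ', smul_eq_mul, S.g_u_u]
      linear_combination S.F P Q * S.ε_mul_ε
    have h8 := S.der_F S.u S.u P
    rw [F_u_left, F_u_left, der_zero, S.F_skew _ P] at h8
    have h9 : S.F P (S.nab S.u S.u) = S.α (S.Ω P) := S.symm _ _
    have h10 := S.T_skew S.u S.u P
    simp only [T, map_add, map_smul, smul_eq_mul] at h7 h8 h10 ⊢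
    linear_combination h7 + S.ε * S.F P Q * (h9 - h8 - h10)
  have h := S.ricci S.u P P Q
  rw [T_u_eq_zero hC hP hQ, der_zero, h1, h5, h6, S.nab_u_spatial hP, hP, hQ, S.F_self, S.F_u,
    S.F_u_left, h4, S.F_skew (S.Ω P), S.T_skew _ P Q, S.T_skew P (S.nab S.u P),
    S.T_skew P P (S.nab S.u Q)] at h
  have k1 := T_u_spatial (Q := P) hQ
  have k2 := T_u_spatial (Q := P) hP
  rw [T_u_eq_zero hC hQ hP] at k1
  rw [T_u_eq_zero hC hP hP] at k2
  rw [hCu]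
  have e1 : S.F P (S.Ω P) = S.g (S.Ω P) (S.Ω P) := rfl
  have e2 : S.F Q (S.Ω P) = S.g (S.Ω Q) (S.Ω P) := rfl
  rw [S.F_skew _ P] at h3
  have h9 : 2 * (S.ε * (S.F P Q * (S.C S.u P - -S.α (S.Ω P)))) = 0 := by
    rw [e1, e2] at h
    linear_combination h - h2 + h3 - S.ε * S.α P * k1 + S.ε * S.α Q * k2
      - S.κ * (S.g P P * S.α Q - S.α P * S.g Q P) * S.ε_mul_ε
  have h10 := eq_zero_of_two_mul h9
  linear_combination S.ε * h10 - S.F P Q * (S.C S.u P + S.α (S.Ω P)) * S.ε_mul_ε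

/-- In constant curvature, the acceleration of a rigid rotating flow is closed. -/
theorem C_symm {X₀ Y₀ : L} (hX₀ : S.g S.u X₀ = 0) (hY₀ : S.g S.u Y₀ = 0)
    (hreg : ∀ a, S.F X₀ Y₀ * a = 0 → a = 0) (X Y : L) : S.C X Y = S.C Y X := by
  have hadd (X Y Z) : S.C (X + Y) Z = S.C X Z + S.C Y Z := by simp [C]
  have hadd' (X Y Z) : S.C X (Y + Z) = S.C X Y + S.C X Z := by simp [C]
  let H : AddSubgroup L := (S.g S.u).toAddMonoidHom.ker
  have hF (X Y Z) : S.F (X + Y) Z = S.F X Z + S.F Y Z := by simp [F]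
  have hF' (X Y Z) : S.F X (Y + Z) = S.F X Y + S.F X Z := by simp [F]
  have hC (P Q) (hP : S.g S.u P = 0) (hQ : S.g S.u Q = 0) : S.C P Q = S.C Q P := by
    rw [← sub_eq_zero]
    exact bilin_eq_zero_of_mul_eq_zero S.F (fun X Y ↦ S.C X Y - S.C Y X) hF hF'
      (fun _ _ _ ↦ by rw [hadd, hadd']; ring) (fun _ _ _ ↦ by rw [hadd, hadd']; ring) H
      (fun X hX Y hY ↦ F_mul_C_sub hX hY) hX₀ hY₀ hreg P hP Q hQ
  -- The second factor depends on `P` alone, so comparing `X₀ + P` with `P` is enough.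
  have hCu (P) (hP : S.g S.u P = 0) : S.C S.u P = S.C P S.u := by
    have hX₀' : S.C S.u X₀ - S.C X₀ S.u = 0 := hreg _ (F_mul_C_u_sub hC hX₀ hY₀)
    have e1 := F_mul_C_u_sub hC (P := X₀ + P) (by rw [map_add, hX₀, hP, add_zero]) hY₀
    have e2 := F_mul_C_u_sub hC hP hY₀
    rw [hadd, hadd', hF] at e1
    exact sub_eq_zero.1 (hreg _ (by linear_combination e1 - (S.F X₀ Y₀ + S.F P Y₀) * hX₀' - e2))
  have hp (X : L) : S.g S.u (X - (S.ε * S.g S.u X) • S.u) = 0 := by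
    rw [map_sub, map_smul, smul_eq_mul, g_u_u]
    linear_combination -S.g S.u X * S.ε_mul_ε
  have e1 := hC _ _ (hp X) (hp Y)
  have e2 := hCu _ (hp X)
  have e3 := hCu _ (hp Y)
  simp only [C, S.nab_smul_left, map_sub, AddMonoidHom.sub_apply, LinearMap.sub_apply, map_smul,
    LinearMap.smul_apply, smul_eq_mul] at e1 e2 e3 ⊢
  linear_combination e1 - S.ε * S.g S.u Y * e2 + S.ε * S.g S.u X * e3

end torsionfree

end RigidUnitField

end RigidFlow

/-! ### Smoothness of derivatives and covariant derivatives -/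

noncomputable section

namespace RigidFlow

open Filter Topology

section Matrix

variable {E : Type*} [NormedAddCommGroup E] [NormedSpace ℝ E]
  {M : Type*} [TopologicalSpace M] [ChartedSpace E M]

lemma contMDiffAt_det {ι : Type*} [Fintype ι] [DecidableEq ι] {A : M → Matrix ι ι ℝ} {x : M}
    (h : ∀ i j, CMDiffAt ∞ (fun y ↦ A y i j) x) : CMDiffAt ∞ (fun y ↦ (A y).det) x := by
  simp only [Matrix.det_apply, Units.smul_def, zsmul_eq_mul]
  exact contMDiffAt_finsetSum fun σ _ ↦
    contMDiffAt_const.mul (contMDiffAt_finsetProd fun i _ ↦ h _ _)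

lemma contMDiffAt_adjugate {ι : Type*} [Fintype ι] [DecidableEq ι] {A : M → Matrix ι ι ℝ} {x : M}
    (h : ∀ i j, CMDiffAt ∞ (fun y ↦ A y i j) x) (i j : ι) :
    CMDiffAt ∞ (fun y ↦ (A y).adjugate i j) x := by
  simp only [Matrix.adjugate_apply]
  refine contMDiffAt_det fun k l ↦ ?_
  simp only [Matrix.updateRow_apply]
  split_ifs
  · exact contMDiffAt_const
  · exact h k l

end Matrix

variable {E : Type*} [NormedAddCommGroup E] [NormedSpace ℝ E]
  {M : Type*} [TopologicalSpace M] [ChartedSpace E M]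
  [IsManifold 𝓘(ℝ, E) ∞ M] (g : PseudoRiemannianMetric E M)

lemma SmoothAt.mdiffAt {X : VField E M} {x : M} (h : SmoothAt X x) : MDiffAt (T% X) x :=
  ContMDiffAt.mdifferentiableAt h (by simp)

lemma SmoothAt.eventually_mdiffAt {X : VField E M} {x : M} (h : SmoothAt X x) :
    ∀ᶠ y in 𝓝 x, MDiffAt (T% X) y := by
  have h1 : CMDiffAt 1 (T% X) x := ContMDiffAt.of_le h (by exact_mod_cast le_top)
  filter_upwards [(contMDiffAt_iff_contMDiffAt_nhds (by simp)).1 h1] with y hy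
  exact hy.mdifferentiableAt (by simp)

lemma SmoothAt.form {X Y : VField E M} {x : M} (hX : SmoothAt X x) (hY : SmoothAt Y x) :
    CMDiffAt ∞ (fun y ↦ g.form y (X y) (Y y)) x := by
  have : ContMDiffAt 𝓘(ℝ, E) (𝓘(ℝ, E).prod 𝓘(ℝ)) ∞
      (fun y ↦ TotalSpace.mk' ℝ (E := Bundle.Trivial M ℝ) y (g.form y (X y) (Y y))) x :=
    ContMDiffAt.clm_bundle_apply₂ (F₁ := E) (F₂ := E) g.contMDiff.contMDiffAt hX hY
  rw [contMDiffAt_totalSpace] at this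
  exact this.2

variable [FiniteDimensional ℝ E]

lemma SmoothAt.bracket {X Y : VField E M} {x : M} (hX : SmoothAt X x) (hY : SmoothAt Y x) :
    SmoothAt (mlieBracket 𝓘(ℝ, E) X Y) x := by
  have : CompleteSpace E := FiniteDimensional.complete ℝ E
  have : IsManifold 𝓘(ℝ, E) (((⊤ : ℕ∞) : ℕ∞ω) + 1) M := by
    simpa using ‹IsManifold 𝓘(ℝ, E) ∞ M›
  have : IsManifold 𝓘(ℝ, E) (minSmoothness ℝ 2) M := by
    rw [minSmoothness_of_isRCLikeNormedField]; infer_instance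
  exact ContMDiffAt.mlieBracket_vectorField (m := ⊤) (n := ⊤) hX hY (by simp)

/-- For a member `s` of a local frame, `[X, f s] - f [X, s] = df(X) s`. So `df(X)` is a frame
coefficient of a smooth field, by smoothness of brackets. The zero-dimensional case, which has no
such `s`, is separate. -/
lemma SmoothAt.mvfderiv_apply {f : M → ℝ} {X : VField E M} {x : M} (hf : CMDiffAt ∞ f x)
    (hX : SmoothAt X x) : CMDiffAt ∞ (fun y ↦ d% f y (X y)) x := by
  have : CompleteSpace E := FiniteDimensional.complete ℝ E
  rcases subsingleton_or_nontrivial E with hE | hE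
  · have (y : M) : X y = 0 := Subsingleton.elim (α := E) _ _
    simp only [this, map_zero]
    exact contMDiffAt_const
  let e := trivializationAt E (TangentSpace 𝓘(ℝ, E) : M → Type _) x
  have hx : x ∈ e.baseSet := FiberBundle.mem_baseSet_trivializationAt' x
  let b := Module.finBasis ℝ E
  have : Nonempty (Fin (Module.finrank ℝ E)) := ⟨⟨0, Module.finrank_pos⟩⟩
  let i : Fin (Module.finrank ℝ E) := Classical.arbitrary _
  let s : VField E M := e.localFrame b i
  have hs : SmoothAt s x := contMDiffAt_localFrame_of_mem _ e b i hx
  have h1 : SmoothAt (mlieBracket 𝓘(ℝ, E) X (f • s) - f • mlieBracket 𝓘(ℝ, E) X s) x :=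
    ContMDiffAt.sub_section (hX.bracket (ContMDiffAt.smul_section hf hs))
      (ContMDiffAt.smul_section hf (hX.bracket hs))
  have h2 := contMDiffAt_localFrameCoeff b hx h1 i
  refine h2.congr_of_eventuallyEq ?_
  have hf1 : CMDiffAt 1 f x := hf.of_le (by exact_mod_cast le_top)
  filter_upwards [(contMDiffAt_iff_contMDiffAt_nhds (by simp)).1 hf1, hs.eventually_mdiffAt,
    e.open_baseSet.mem_nhds hx] with y hy hsy hye
  simp only [LinearMap.piApply_apply_apply, Pi.sub_apply, Pi.smul_apply',
    mlieBracket_smul_right (hy.mdifferentiableAt (by simp)) hsy, add_sub_cancel_right]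
  rw [map_smul]
  have hc : e.localFrameCoeff 𝓘(ℝ, E) b i y (s y) = 1 := by
    rw [e.localFrameCoeff_apply_of_mem_baseSet b hye s]
    simp [s, hye]
  rw [hc, smul_eq_mul, mul_one]

lemma SmoothAt.koszul_apply {X Y Z : VField E M} {x : M} (hX : SmoothAt X x) (hY : SmoothAt Y x)
    (hZ : SmoothAt Z x) : CMDiffAt ∞ (koszul g X Y Z) x := by
  unfold RigidFlow.koszul
  have h1 := mvfderiv_apply (hY.form g hZ) hX
  have h2 := mvfderiv_apply (hZ.form g hX) hY
  have h3 := mvfderiv_apply (hX.form g hY) hZ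
  have h4 := (hX.bracket hY).form g hZ
  have h5 := (hY.bracket hZ).form g hX
  have h6 := (hZ.bracket hX).form g hY
  exact ((((h1.add h2).sub h3).add h4).sub h5).add h6

/-- A vector field is smooth if its inner products with smooth fields are. -/
lemma smoothAt_of_form {Z : VField E M} {x : M}
    (h : ∀ X : VField E M, SmoothAt X x → CMDiffAt ∞ (fun y ↦ g.form y (Z y) (X y)) x) :
    SmoothAt Z x := by
  let e := trivializationAt E (TangentSpace 𝓘(ℝ, E) : M → Type _) x
  have hx : x ∈ e.baseSet := FiberBundle.mem_baseSet_trivializationAt' x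
  let b := Module.finBasis ℝ E
  let s : Fin (Module.finrank ℝ E) → VField E M := e.localFrame b
  have hs i : SmoothAt (s i) x := contMDiffAt_localFrame_of_mem _ e b i hx
  -- The Gram matrix of a local frame is invertible by nondegeneracy. Cramer's rule then recovers
  -- the frame coefficients of `Z` smoothly from its inner products.
  let G (y : M) : Matrix (Fin (Module.finrank ℝ E)) (Fin (Module.finrank ℝ E)) ℝ :=
    Matrix.of fun i j ↦ g.form y (s i y) (s j y)
  have hG i j : CMDiffAt ∞ (fun y ↦ G y i j) x := (hs i).form g (hs j)
  have hdet {y : M} (hy : y ∈ e.baseSet) : (G y).det ≠ 0 := by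
    intro h0
    obtain ⟨v, hv, hv0⟩ := Matrix.exists_mulVec_eq_zero_iff.2 h0
    apply hv
    have h1 : ∑ j, v j • s j y = 0 := by
      refine g.nondegenerate y _ fun w ↦ ?_
      have : (g.form y (∑ j, v j • s j y) : TangentSpace 𝓘(ℝ, E) y →ₗ[ℝ] ℝ) = 0 := by
        refine ((e.isLocalFrameOn_localFrame_baseSet 𝓘(ℝ, E) ∞ b).toBasisAt hy).ext fun i ↦ ?_
        have := congrFun hv0 i
        simp only [Matrix.mulVec, dotProduct, G, Matrix.of_apply, Pi.zero_apply] at this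
        rw [IsLocalFrameOn.toBasisAt_coe]
        simpa [s, mul_comm, g.symm y (e.localFrame b i y)] using this
      exact congr($this w)
    have h2 := (e.isLocalFrameOn_localFrame_baseSet 𝓘(ℝ, E) ∞ b).linearIndependent hy
    exact funext (Fintype.linearIndependent_iff.1 h2 v h1)
  have hadj := contMDiffAt_adjugate hG
  refine (contMDiffAt_iff_localFrameCoeff b hx).2 fun i ↦ ?_
  have h3 : CMDiffAt ∞ (fun y ↦ (G y).det⁻¹ *
      ∑ j, g.form y (Z y) (s j y) * (G y).adjugate j i) x :=
    ((contMDiffAt_det hG).inv₀ (hdet hx)).mul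
      (contMDiffAt_finsetSum fun j _ ↦ (h _ (hs j)).mul (hadj j i))
  refine h3.congr_of_eventuallyEq ?_
  filter_upwards [e.open_baseSet.mem_nhds hx] with y hy
  rw [eq_inv_mul_iff_mul_eq₀ (hdet hy), LinearMap.piApply_apply_apply]
  have h4 : (fun j ↦ g.form y (Z y) (s j y)) =
      Matrix.vecMul (fun i ↦ e.localFrameCoeff 𝓘(ℝ, E) b i y (Z y)) (G y) := by
    ext j
    conv_lhs => rw [e.eq_sum_localFrameCoeff_smul (I := 𝓘(ℝ, E)) (b := b) (s := Z) hy]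
    simp [Matrix.vecMul, dotProduct, G, s]
  have h5 := congrFun (congrArg (fun v ↦ Matrix.vecMul v (G y).adjugate) h4) i
  simp only [Matrix.vecMul_vecMul, Matrix.mul_adjugate] at h5
  simpa [Matrix.vecMul, dotProduct, Matrix.one_apply, mul_comm] using h5.symm

lemma form_leviCivita {X Y Z : VField E M} {x : M}
    (hX : MDiffAt (T% X) x) (hY : MDiffAt (T% Y) x) (hZ : MDiffAt (T% Z) x) :
    g.form x (leviCivita g Y x (X x)) (Z x) = koszul g X Y Z x / 2 := by
  have := form_leviCivitaFun g hX hY hZ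
  change 2 * g.form x (leviCivita g Y x (X x)) (Z x) = _ at this
  linarith

lemma SmoothAt.covDeriv {X Y : VField E M} {x : M} (hX : SmoothAt X x) (hY : SmoothAt Y x) :
    SmoothAt (fun y ↦ leviCivita g Y y (X y)) x := by
  refine smoothAt_of_form g fun Z hZ ↦ ?_
  refine (((hX.koszul_apply g hY hZ)).mul (contMDiffAt_const (c := (1 / 2 : ℝ)))).congr_of_eventuallyEq ?_
  filter_upwards [hX.eventually_mdiffAt, hY.eventually_mdiffAt, hZ.eventually_mdiffAt]
    with y h1 h2 h3
  rw [form_leviCivita g h1 h2 h3, Pi.mul_apply]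
  ring

end RigidFlow

end

/-! ### Smooth functions and fields on an open set, extended by zero -/

noncomputable section

namespace RigidFlow

open Filter Topology

section Extension

variable {E : Type*} [NormedAddCommGroup E] [NormedSpace ℝ E]
  {M : Type*} [TopologicalSpace M] [ChartedSpace E M]

open Classical in
/-- Extension of a function on `W` by zero. -/
def extFun {W : TopologicalSpace.Opens M} (f : W → ℝ) : M → ℝ :=
  fun x ↦ if h : x ∈ W then f ⟨x, h⟩ else 0

open Classical in
/-- Extension of a vector field on `W` by zero. -/
def extField {W : TopologicalSpace.Opens M} (X : Π x : W, TangentSpace 𝓘(ℝ, E) (x : M)) :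
    VField E M :=
  fun x ↦ if h : x ∈ W then X ⟨x, h⟩ else 0

variable {W : TopologicalSpace.Opens M}

lemma extFun_apply (f : W → ℝ) (x : W) : extFun f x = f x := dif_pos x.2

lemma extField_apply (X : Π x : W, TangentSpace 𝓘(ℝ, E) (x : M)) (x : W) :
    extField X x = X x := dif_pos x.2

lemma extFun_eventuallyEq {f : W → ℝ} {F : M → ℝ} (h : ∀ x : W, f x = F x) (x : W) :
    extFun f =ᶠ[𝓝 (x : M)] F := by
  filter_upwards [W.2.mem_nhds x.2] with y hy
  exact (extFun_apply f ⟨y, hy⟩).trans (h ⟨y, hy⟩)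

lemma extField_eventuallyEq {X : Π x : W, TangentSpace 𝓘(ℝ, E) (x : M)} {Y : VField E M}
    (h : ∀ x : W, X x = Y x) (x : W) : ∀ᶠ y in 𝓝 (x : M), extField X y = Y y := by
  filter_upwards [W.2.mem_nhds x.2] with y hy
  exact (extField_apply X ⟨y, hy⟩).trans (h ⟨y, hy⟩)

lemma extFun_add (f f' : W → ℝ) : extFun (f + f') = extFun f + extFun f' := by
  ext x; by_cases h : x ∈ W <;> simp [extFun, h]

lemma extFun_mul (f f' : W → ℝ) : extFun (f * f') = extFun f * extFun f' := by
  ext x; by_cases h : x ∈ W <;> simp [extFun, h]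

lemma extField_add (X Y : Π x : W, TangentSpace 𝓘(ℝ, E) (x : M)) :
    extField (X + Y) = extField X + extField Y := by
  ext x; by_cases h : x ∈ W <;> simp [extField, h]

lemma extField_smul (f : W → ℝ) (X : Π x : W, TangentSpace 𝓘(ℝ, E) (x : M)) :
    extField (f • X) = extFun f • extField X := by
  ext x; by_cases h : x ∈ W <;> simp [extField, extFun, h]

end Extension

variable {E : Type*} [NormedAddCommGroup E] [NormedSpace ℝ E]
  {M : Type*} [TopologicalSpace M] [ChartedSpace E M]

/-- The algebra of smooth functions on `W`. -/
def smoothFun (E : Type*) [NormedAddCommGroup E] [NormedSpace ℝ E]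
    {M : Type*} [TopologicalSpace M] [ChartedSpace E M] (W : TopologicalSpace.Opens M) :
    Subalgebra ℝ (W → ℝ) where
  carrier := {f | ∀ x : W, ContMDiffAt 𝓘(ℝ, E) 𝓘(ℝ) ∞ (extFun f) x}
  mul_mem' hf hf' x := by rw [extFun_mul]; exact (hf x).mul (hf' x)
  add_mem' hf hf' x := by rw [extFun_add]; exact (hf x).add (hf' x)
  algebraMap_mem' c x :=
    contMDiffAt_const.congr_of_eventuallyEq (extFun_eventuallyEq (F := fun _ ↦ c) (fun _ ↦ rfl) x)

lemma mem_smoothFun {W : TopologicalSpace.Opens M} {F : M → ℝ}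
    (h : ∀ x ∈ W, ContMDiffAt 𝓘(ℝ, E) 𝓘(ℝ) ∞ F x) : (fun x : W ↦ F x) ∈ smoothFun E W :=
  fun x ↦ (h x x.2).congr_of_eventuallyEq (extFun_eventuallyEq (fun _ ↦ rfl) x)

instance (W : TopologicalSpace.Opens M) : IsAddTorsionFree (smoothFun E W) where
  nsmul_right_injective n hn f f' h := by
    ext x
    have := congrFun (congrArg Subtype.val h) x
    simpa [hn] using this

variable [IsManifold 𝓘(ℝ, E) ∞ M]

/-- The module of smooth vector fields on `W`. -/
def smoothField (W : TopologicalSpace.Opens M) :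
    Submodule (smoothFun E W) (Π x : W, TangentSpace 𝓘(ℝ, E) (x : M)) where
  carrier := {X | ∀ x : W, SmoothAt (extField X) x}
  add_mem' hX hY x := by rw [extField_add]; exact ContMDiffAt.add_section (hX x) (hY x)
  zero_mem' x := (contMDiffAt_zeroSection ℝ (TangentSpace 𝓘(ℝ, E))).congr_of_eventuallyEq <|
    (extField_eventuallyEq (Y := 0) (fun _ ↦ rfl) x).mono fun y hy ↦
      congrArg (TotalSpace.mk' E y) hy
  smul_mem' f X hX x := by
    change SmoothAt (extField (f.1 • X)) x
    rw [extField_smul]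
    exact ContMDiffAt.smul_section (f.2 x) (hX x)

instance (W : TopologicalSpace.Opens M) : Module (smoothFun E W) (smoothField (E := E) W) :=
  (smoothField W).module

instance (W : TopologicalSpace.Opens M) : SMul (smoothFun E W) (smoothField (E := E) W) :=
  Module.toDistribMulAction.toSMul

lemma SmoothAt.congr {X Y : VField E M} {x : M} (h : SmoothAt X x) (hXY : ∀ᶠ y in 𝓝 x, Y y = X y) :
    SmoothAt Y x :=
  ContMDiffAt.congr_of_eventuallyEq h (hXY.mono fun y hy ↦ congrArg (TotalSpace.mk' E y) hy)

lemma mem_smoothField {W : TopologicalSpace.Opens M} {X : VField E M}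
    (h : ∀ x ∈ W, SmoothAt X x) : (fun x : W ↦ X x) ∈ smoothField (E := E) W :=
  fun x ↦ (h x x.2).congr (extField_eventuallyEq (fun _ ↦ rfl) x)

variable (g : PseudoRiemannianMetric E M)

variable {W : TopologicalSpace.Opens M}

/-- The metric on smooth vector fields on `W`. -/
def formL (W : TopologicalSpace.Opens M) :
    smoothField (E := E) W →ₗ[smoothFun E W] smoothField (E := E) W →ₗ[smoothFun E W]
      smoothFun E W :=
  LinearMap.mk₂ _
    (fun X Y ↦ ⟨fun x ↦ g.form x (extField X.1 x) (extField Y.1 x),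
      mem_smoothFun (F := fun x ↦ g.form x (extField X.1 x) (extField Y.1 x))
        fun x hx ↦ (X.2 ⟨x, hx⟩).form g (Y.2 ⟨x, hx⟩)⟩)
    (fun X X' Y ↦ by ext x; simp [extField_add])
    (fun f X Y ↦ by ext x; simp [Subalgebra.smul_def, extField_smul, extFun_apply])
    (fun X Y Y' ↦ by ext x; simp [extField_add])
    (fun f X Y ↦ by ext x; simp [Subalgebra.smul_def, extField_smul, extFun_apply])

lemma formL_apply (X Y : smoothField (E := E) W) (x : W) :
    (formL g W X Y).1 x = g.form x (X.1 x) (Y.1 x) := by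
  rw [← extField_apply X.1, ← extField_apply Y.1]; rfl

variable [FiniteDimensional ℝ E]

/-- Locality of the connection: the values of a zero extension outside `W` do not affect covariant
derivatives at points of `W`. -/
lemma leviCivita_congr {X Y : VField E M} {x : M} (hX : MDiffAt (T% X) x) (hY : MDiffAt (T% Y) x)
    (h : ∀ᶠ y in 𝓝 x, X y = Y y) : leviCivita g X x = leviCivita g Y x :=
  (leviCivita g).isCovariantDerivativeOn.congr_of_eventuallyEq hX hY univ_mem h

/-- The derivative of a smooth function along a smooth vector field on `W`. -/
def derL (X : smoothField (E := E) W) (f : smoothFun E W) : smoothFun E W :=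
  ⟨fun x ↦ mvfderiv 𝓘(ℝ, E) (extFun f.1) x (extField X.1 x),
    mem_smoothFun (F := fun x ↦ mvfderiv 𝓘(ℝ, E) (extFun f.1) x (extField X.1 x))
      fun x hx ↦ SmoothAt.mvfderiv_apply (f.2 ⟨x, hx⟩) (X.2 ⟨x, hx⟩)⟩

lemma derL_apply (X : smoothField (E := E) W) (f : smoothFun E W) (x : W) :
    (derL X f).1 x = mvfderiv 𝓘(ℝ, E) (extFun f.1) x (X.1 x) := by
  rw [← extField_apply X.1]; rfl

/-- The covariant derivative of smooth vector fields on `W`. -/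
def nabFun (X Y : smoothField (E := E) W) : smoothField (E := E) W :=
  ⟨fun x ↦ leviCivita g (extField Y.1) x (extField X.1 x),
    mem_smoothField (X := fun x ↦ leviCivita g (extField Y.1) x (extField X.1 x))
      fun x hx ↦ (X.2 ⟨x, hx⟩).covDeriv g (Y.2 ⟨x, hx⟩)⟩

lemma nabFun_apply (X Y : smoothField (E := E) W) (x : W) :
    (nabFun g X Y).1 x = leviCivita g (extField Y.1) x (X.1 x) := by
  rw [← extField_apply X.1]; rfl

lemma nabFun_add_left (X X' Y : smoothField (E := E) W) :
    nabFun g (X + X') Y = nabFun g X Y + nabFun g X' Y := by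
  ext x
  rw [Submodule.coe_add, Pi.add_apply]
  simp only [nabFun_apply]
  rw [Submodule.coe_add, Pi.add_apply, map_add]

lemma nabFun_add_right (X Y Y' : smoothField (E := E) W) :
    nabFun g X (Y + Y') = nabFun g X Y + nabFun g X Y' := by
  ext x
  rw [Submodule.coe_add, Pi.add_apply]
  simp only [nabFun_apply]
  have h := (leviCivita g).isCovariantDerivativeOnUniv.add (Y.2 x).mdiffAt (Y'.2 x).mdiffAt
  rw [Submodule.coe_add, extField_add]
  exact congr($h (X.1 x))

lemma nabFun_smul_left (f : smoothFun E W) (X Y : smoothField (E := E) W) :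
    nabFun g (f • X) Y = f • nabFun g X Y := by
  ext x
  change _ = f.1 x • (nabFun g X Y).1 x
  rw [nabFun_apply, nabFun_apply]
  exact map_smul _ (f.1 x) (X.1 x)

lemma nabFun_smul_right (f : smoothFun E W) (X Y : smoothField (E := E) W) :
    nabFun g X (f • Y) = f • nabFun g X Y + derL X f • Y := by
  ext x
  change _ = f.1 x • (nabFun g X Y).1 x + (derL X f).1 x • Y.1 x
  rw [nabFun_apply, nabFun_apply, derL_apply]
  have h := (leviCivita g).isCovariantDerivativeOnUniv.leibniz (Y.2 x).mdiffAt
    ((f.2 x).mdifferentiableAt (by simp))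
  change leviCivita g (extField (f.1 • Y.1)) x _ = _
  rw [extField_smul, ← extFun_apply f.1, ← extField_apply Y.1]
  exact congr($h (X.1 x))

lemma derL_formL (X Y Z : smoothField (E := E) W) :
    derL X (formL g W Y Z) = formL g W (nabFun g X Y) Z + formL g W Y (nabFun g X Z) := by
  ext x
  change _ = (formL g W (nabFun g X Y) Z).1 x + (formL g W Y (nabFun g X Z)).1 x
  have h := leviCivita_metric g (Y.2 x).mdiffAt (Z.2 x).mdiffAt (X.1 x)
  have h2 := (extFun_eventuallyEq (F := fun x ↦ g.form x (extField Y.1 x) (extField Z.1 x))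
    (f := (formL g W Y Z).1) (fun _ ↦ rfl) x).mfderiv_eq (I := 𝓘(ℝ, E)) (I' := 𝓘(ℝ, ℝ))
  rw [extField_apply, extField_apply] at h
  rw [formL_apply, formL_apply, nabFun_apply, nabFun_apply, derL_apply, ← h]
  exact congr($h2 (X.1 x))

lemma leviCivita_extField_nabFun (X Y Z : smoothField (E := E) W) (x : W) :
    (nabFun g X (nabFun g Y Z)).1 x =
      leviCivita g (fun y ↦ leviCivita g (extField Z.1) y (extField Y.1 y)) x (X.1 x) := by
  rw [nabFun_apply, leviCivita_congr g ((nabFun g Y Z).2 x).mdiffAt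
    ((Y.2 x).covDeriv g (Z.2 x)).mdiffAt]
  exact extField_eventuallyEq
    (Y := fun y ↦ leviCivita g (extField Z.1) y (extField Y.1 y)) (fun _ ↦ rfl) x

/-- Torsion-freeness turns the Lie bracket in `curvature` into `∇_X Y - ∇_Y X`, the form used by
`ConstCurvModule`. -/
lemma nabFun_curvature {κ : ℝ}
    (hκ : ∀ (x : M) (X Y Z : VField E M), SmoothAt X x → SmoothAt Y x → SmoothAt Z x →
      curvature g X Y Z x = κ • (g.form x (Y x) (Z x) • X x - g.form x (X x) (Z x) • Y x))
    (X Y Z : smoothField (E := E) W) :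
    nabFun g X (nabFun g Y Z) - nabFun g Y (nabFun g X Z)
        - nabFun g (nabFun g X Y - nabFun g Y X) Z =
      algebraMap ℝ (smoothFun E W) κ • (formL g W Y Z • X - formL g W X Z • Y) := by
  ext x
  have h := hκ x _ _ _ (X.2 x) (Y.2 x) (Z.2 x)
  rw [curvature, ← leviCivita_torsionFree g (X.2 x).mdiffAt (Y.2 x).mdiffAt] at h
  simp only [extField_apply] at h
  change (nabFun g X (nabFun g Y Z)).1 x - (nabFun g Y (nabFun g X Z)).1 x
    - (nabFun g (nabFun g X Y - nabFun g Y X) Z).1 x =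
    κ • ((formL g W Y Z).1 x • X.1 x - (formL g W X Z).1 x • Y.1 x)
  rw [leviCivita_extField_nabFun, leviCivita_extField_nabFun, nabFun_apply, formL_apply,
    formL_apply, ← h]
  change _ - leviCivita g (extField Z.1) x ((nabFun g X Y).1 x - (nabFun g Y X).1 x) = _
  rw [nabFun_apply, nabFun_apply]

/-- Smooth functions and vector fields on an open subset of a manifold of constant curvature. -/
def constCurvModule (W : TopologicalSpace.Opens M) {κ : ℝ}
    (hκ : ∀ (x : M) (X Y Z : VField E M), SmoothAt X x → SmoothAt Y x → SmoothAt Z x →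
      curvature g X Y Z x = κ • (g.form x (Y x) (Z x) • X x - g.form x (X x) (Z x) • Y x)) :
    ConstCurvModule (smoothFun E W) (smoothField (E := E) W) where
  g := formL g W
  symm X Y := by ext x; exact g.symm _ _ _
  der := derL
  der_add X f f' := by
    ext x
    have h := mvfderiv_add ((f.2 x).mdifferentiableAt (by simp))
      ((f'.2 x).mdifferentiableAt (by simp))
    change (derL X (f + f')).1 x = (derL X f).1 x + (derL X f').1 x
    rw [derL_apply, derL_apply, derL_apply]
    change mvfderiv 𝓘(ℝ, E) (extFun (f.1 + f'.1)) x _ = _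
    rw [extFun_add]
    exact congr($h (X.1 x))
  der_mul X f f' := by
    ext x
    have h := mvfderiv_mul ((f.2 x).mdifferentiableAt (by simp))
      ((f'.2 x).mdifferentiableAt (by simp))
    change (derL X (f * f')).1 x = f.1 x * (derL X f').1 x + f'.1 x * (derL X f).1 x
    rw [derL_apply, derL_apply, derL_apply]
    change mvfderiv 𝓘(ℝ, E) (extFun (f.1 * f'.1)) x _ = _
    rw [extFun_mul, ← extFun_apply f.1, ← extFun_apply f'.1]
    exact congr($h (X.1 x))
  nab := AddMonoidHom.mk' (fun X ↦ AddMonoidHom.mk' (nabFun g X) (nabFun_add_right g X))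
    fun X X' ↦ AddMonoidHom.ext fun Y ↦ nabFun_add_left g X X' Y
  nab_smul_left := nabFun_smul_left g
  nab_smul_right := nabFun_smul_right g
  metric := derL_formL g
  κ := algebraMap ℝ _ κ
  curv := nabFun_curvature g hκ

end RigidFlow

end

/-! ### The unit field of a Born-rigid flow -/

noncomputable section

namespace RigidFlow

open Filter Topology

section

variable {E : Type*} [NormedAddCommGroup E] [NormedSpace ℝ E]
  {M : Type*} [TopologicalSpace M] [ChartedSpace E M]

lemma contMDiffAt_inv_sqrt_abs {h : M → ℝ} {x : M} (hh : CMDiffAt ∞ h x) (h0 : h x ≠ 0) :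
    CMDiffAt ∞ (fun y ↦ (√|h y|)⁻¹) x := by
  have h1 : ContDiffAt ℝ ∞ (fun t : ℝ ↦ (√|t|)⁻¹) (h x) :=
    ((contDiffAt_abs h0).sqrt (abs_ne_zero.2 h0)).inv (Real.sqrt_ne_zero'.2 (abs_pos.2 h0))
  exact h1.contMDiffAt.comp x hh

end

variable {E : Type*} [NormedAddCommGroup E] [NormedSpace ℝ E]
  {M : Type*} [TopologicalSpace M] [ChartedSpace E M]
  [IsManifold 𝓘(ℝ, E) ∞ M] (g : PseudoRiemannianMetric E M) {V : VField E M}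

lemma SmoothAt.unitField {x : M} (hV : SmoothAt V x) (h : g.form x (V x) (V x) ≠ 0) :
    SmoothAt (unitField g V) x :=
  ContMDiffAt.smul_section (contMDiffAt_inv_sqrt_abs (hV.form g hV) h) hV

lemma form_unitField_self (x : M) :
    g.form x (unitField g V x) (unitField g V x) =
      (|g.form x (V x) (V x)|)⁻¹ * g.form x (V x) (V x) := by
  simp only [unitField, map_smul, smul_apply, smul_eq_mul]
  rw [← mul_assoc, ← mul_inv, Real.mul_self_sqrt (abs_nonneg _)]

lemma form_unitField_mul_self {x : M} (h : g.form x (V x) (V x) ≠ 0) :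
    g.form x (unitField g V x) (unitField g V x) * g.form x (unitField g V x) (unitField g V x) =
      1 := by
  rw [form_unitField_self, mul_mul_mul_comm, ← mul_inv, abs_mul_abs_self,
    inv_mul_cancel₀ (mul_ne_zero h h)]

lemma form_eq_zero_of_unitField {x : M} (h : g.form x (V x) (V x) ≠ 0)
    {a : TangentSpace 𝓘(ℝ, E) x} (ha : g.form x (unitField g V x) a = 0) :
    g.form x (V x) a = 0 := by
  simp only [unitField, map_smul, smul_apply, smul_eq_mul] at ha
  exact (mul_eq_zero.1 ha).resolve_left (inv_ne_zero (Real.sqrt_ne_zero'.2 (abs_pos.2 h)))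

lemma proj_apply (x : M) (a : TangentSpace 𝓘(ℝ, E) x) :
    proj g V x a = a - ((g.form x (V x) (V x))⁻¹ * g.form x (V x) a) • V x := rfl

lemma form_proj_right (x : M) (a b : TangentSpace 𝓘(ℝ, E) x) :
    g.form x a (proj g V x b) = g.form x (proj g V x a) b := by
  simp only [proj_apply, map_sub, map_smul, sub_apply, smul_apply, smul_eq_mul, g.symm x _ (V x)]
  ring

lemma form_proj {x : M} (h : g.form x (V x) (V x) ≠ 0) (a : TangentSpace 𝓘(ℝ, E) x) :
    g.form x (V x) (proj g V x a) = 0 := by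
  simp only [proj_apply, map_sub, map_smul, smul_eq_mul]
  field_simp
  ring

lemma proj_eq_self {x : M} {a : TangentSpace 𝓘(ℝ, E) x} (ha : g.form x (V x) a = 0) :
    proj g V x a = a := by
  simp [proj_apply, ha]

lemma SmoothAt.proj {X : VField E M} {x : M} (hX : SmoothAt X x) (hV : SmoothAt V x)
    (h : g.form x (V x) (V x) ≠ 0) : SmoothAt (fun y ↦ proj g V y (X y)) x :=
  ContMDiffAt.sub_section hX
    (ContMDiffAt.smul_section (((hV.form g hV).inv₀ h).mul (hV.form g hX)) hV)

variable [FiniteDimensional ℝ E]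

lemma kinematic_eq (x : M) (a b : TangentSpace 𝓘(ℝ, E) x) : kinematic g V x a b =
    g.form x (proj g V x a) (leviCivita g (unitField g V) x (proj g V x b)) :=
  form_proj_right g x _ _

variable {g}

lemma IsBornRigid.kinematic_add (hrigid : IsBornRigid g V) (x : M) (a b : TangentSpace 𝓘(ℝ, E) x) :
    kinematic g V x a b + kinematic g V x b a = 0 := by
  have h := (hrigid x).2 a b
  -- Zero expansion removes the trace term, also in dimension one, where its denominator is `0`.
  rw [shear, (hrigid x).1, zero_div, zero_mul, sub_zero] at h
  linarith

lemma IsRotatingAt.exists_kinematic_ne_zero {p : M} (hp : IsRotatingAt g V p) :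
    ∃ a b, kinematic g V p a b ≠ 0 := by
  obtain ⟨a, b, hab⟩ := hp
  by_contra! h
  exact hab (by simp [rotation, h])

/-- The unit field of a rigid flow. -/
def rigidUnitField (W : TopologicalSpace.Opens M) {κ : ℝ}
    (hκ : ∀ (x : M) (X Y Z : VField E M), SmoothAt X x → SmoothAt Y x → SmoothAt Z x →
      curvature g X Y Z x = κ • (g.form x (Y x) (Z x) • X x - g.form x (X x) (Z x) • Y x))
    (hV : ∀ x, SmoothAt V x) (hnn : IsNonNull g V) (hrigid : IsBornRigid g V) :
    RigidUnitField (smoothFun E W) (smoothField (E := E) W) where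
  toConstCurvModule := constCurvModule g W hκ
  u := ⟨fun x ↦ unitField g V x,
    mem_smoothField (X := unitField g V) fun x _ ↦ (hV x).unitField g (hnn x)⟩
  unit := by
    ext x
    change (formL g W _ _).1 x * (formL g W _ _).1 x = 1
    rw [formL_apply]
    exact form_unitField_mul_self g (hnn x)
  rigid X Y hX hY := by
    ext x
    have hX' := form_eq_zero_of_unitField g (hnn x) (a := X.1 x) (by
      rw [← formL_apply g (⟨fun x ↦ unitField g V x, _⟩ : smoothField W)]
      exact congrFun (congrArg Subtype.val hX) x)
    have hY' := form_eq_zero_of_unitField g (hnn x) (a := Y.1 x) (by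
      rw [← formL_apply g (⟨fun x ↦ unitField g V x, _⟩ : smoothField W)]
      exact congrFun (congrArg Subtype.val hY) x)
    have h := hrigid.kinematic_add x (X.1 x) (Y.1 x)
    rw [kinematic_eq, kinematic_eq, proj_eq_self g hX', proj_eq_self g hY',
      g.symm x (X.1 x), g.symm x (Y.1 x)] at h
    change (formL g W (nabFun g X _) Y).1 x + (formL g W (nabFun g Y _) X).1 x = 0
    have hu : leviCivita g (extField fun x : W ↦ unitField g V x) x =
        leviCivita g (unitField g V) x :=
      leviCivita_congr g ((mem_smoothField (X := unitField g V)
        fun x _ ↦ (hV x).unitField g (hnn x)) x).mdiffAt ((hV x).unitField g (hnn x)).mdiffAt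
        (extField_eventuallyEq (fun _ ↦ rfl) x)
    rw [formL_apply, formL_apply, nabFun_apply, nabFun_apply, hu, add_comm]
    exact h

end RigidFlow

end

/-! ### Coordinate fields and the Poincaré lemma -/

noncomputable section

namespace RigidFlow

open Filter Topology

variable {E : Type*} [NormedAddCommGroup E] [NormedSpace ℝ E]
  {M : Type*} [TopologicalSpace M] [ChartedSpace E M]

/-- A constant vector field on `E`. -/
def constField (v : E) : VField E E := fun _ ↦ v

/-- The vector field which is constant in the chart at `p`. -/
def coordField (p : M) (v : E) : VField E M :=
  mpullback 𝓘(ℝ, E) 𝓘(ℝ, E) (extChartAt 𝓘(ℝ, E) p) (constField v)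

/-- The derivative of the chart at `p`. -/
def chartDeriv (p y : M) : TangentSpace 𝓘(ℝ, E) y →L[ℝ] E :=
  mfderiv 𝓘(ℝ, E) 𝓘(ℝ, E) (extChartAt 𝓘(ℝ, E) p) y

variable [IsManifold 𝓘(ℝ, E) ∞ M] {p y : M}

lemma isInvertible_chartDeriv (hy : y ∈ (extChartAt 𝓘(ℝ, E) p).source) :
    (chartDeriv (E := E) p y).IsInvertible :=
  isInvertible_mfderiv_extChartAt hy

lemma coordField_chartDeriv (hy : y ∈ (extChartAt 𝓘(ℝ, E) p).source) (w : TangentSpace 𝓘(ℝ, E) y) :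
    coordField p (chartDeriv p y w) y = w :=
  (isInvertible_chartDeriv hy).inverse_apply_self w

lemma chartDeriv_coordField (hy : y ∈ (extChartAt 𝓘(ℝ, E) p).source) (v : E) :
    chartDeriv p y (coordField p v y) = v :=
  (isInvertible_chartDeriv hy).self_apply_inverse v

lemma smoothAt_constField (v z : E) : SmoothAt (constField v) z :=
  contMDiffAt_vectorSpace_iff_contDiffAt.2 contDiffAt_const

lemma lieBracket_constField (v w : E) :
    mlieBracket 𝓘(ℝ, E) (constField v) (constField w) = 0 := by
  rw [← mlieBracketWithin_univ, mlieBracketWithin_eq_lieBracketWithin]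
  ext z
  change fderivWithin ℝ (fun _ : E ↦ w) Set.univ z v - fderivWithin ℝ (fun _ : E ↦ v) Set.univ z w
    = 0
  simp

lemma mvfderiv_comp_chart {F : E → ℝ} (hy : y ∈ (extChartAt 𝓘(ℝ, E) p).source)
    (hF : DifferentiableAt ℝ F (extChartAt 𝓘(ℝ, E) p y)) (v : TangentSpace 𝓘(ℝ, E) y) :
    d% (fun x ↦ F (extChartAt 𝓘(ℝ, E) p x)) y v =
      fderiv ℝ F (extChartAt 𝓘(ℝ, E) p y) (chartDeriv p y v) := by
  have h := mfderiv_comp (I := 𝓘(ℝ, E)) (I' := 𝓘(ℝ, E)) (I'' := 𝓘(ℝ, ℝ)) y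
    hF.mdifferentiableAt (mdifferentiableAt_extChartAt (I := 𝓘(ℝ, E)) (x := p) (y := y)
      (by simpa using hy))
  rw [mfderiv_eq_fderiv] at h
  exact congr($h v)

lemma exists_primitive_on_convex [FiniteDimensional ℝ E] {s : Set E} (hs : Convex ℝ s)
    (hso : IsOpen s) {θ : E → E →L[ℝ] ℝ} (hθ : ContDiffOn ℝ ∞ θ s)
    (hsymm : ∀ z ∈ s, ∀ v w, fderiv ℝ θ z v w = fderiv ℝ θ z w v) :
    ∃ F : E → ℝ, ContDiffOn ℝ ∞ F s ∧ ∀ z ∈ s, HasFDerivAt F (θ z) z := by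
  obtain ⟨F, hF⟩ := hs.exists_forall_hasFDerivAt_of_fderiv_symmetric hso
    (hθ.differentiableOn (by simp)) hsymm
  refine ⟨F, (contDiffOn_infty_iff_fderiv_of_isOpen hso).2
    ⟨fun z hz ↦ (hF z hz).differentiableAt.differentiableWithinAt,
      hθ.congr fun z hz ↦ (hF z hz).fderiv⟩, hF⟩

variable [CompleteSpace E]

lemma smoothAt_coordField (hy : y ∈ (extChartAt 𝓘(ℝ, E) p).source) (v : E) :
    SmoothAt (coordField p v) y := by
  have h : SmoothAt (M := E) (constField v) (extChartAt 𝓘(ℝ, E) p y) := smoothAt_constField v _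
  exact ContMDiffAt.mpullback_vectorField_preimage (n := ∞) h
    (contMDiffAt_extChartAt' (by simpa using hy)) (isInvertible_mfderiv_extChartAt hy) (by simp)

lemma mlieBracket_coordField (hy : y ∈ (extChartAt 𝓘(ℝ, E) p).source) (v w : E) :
    mlieBracket 𝓘(ℝ, E) (coordField p v) (coordField p w) y = 0 := by
  have : IsManifold 𝓘(ℝ, E) (minSmoothness ℝ 2) M := by
    rw [minSmoothness_of_isRCLikeNormedField]; infer_instance
  have h := mpullback_mlieBracket (n := ∞) (smoothAt_constField v _).mdiffAt
    (smoothAt_constField w _).mdiffAt (contMDiffAt_extChartAt' (I := 𝓘(ℝ, E)) (x := p) (x' := y)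
      (by simpa using hy)) (by
      rw [minSmoothness_of_isRCLikeNormedField]; exact WithTop.coe_le_coe.2 le_top)
  rw [lieBracket_constField] at h
  rw [coordField, coordField, ← h]
  simp [mpullback_apply]

variable (g : PseudoRiemannianMetric E M) {a : VField E M}

/-- Closedness of `a♭` in coordinates. Coordinate fields commute, so the terms `g(a, ∇_w ∂_v)` and
`g(a, ∇_v ∂_w)` agree, and the remaining ones agree by the symmetry of `∇a`. -/
lemma mvfderiv_form_coordField_comm [FiniteDimensional ℝ E]
    (hy : y ∈ (extChartAt 𝓘(ℝ, E) p).source) (ha : SmoothAt a y)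
    (hsymm : ∀ v w, g.form y (leviCivita g a y v) w = g.form y (leviCivita g a y w) v) (v w : E) :
    d% (fun x ↦ g.form x (a x) (coordField p v x)) y (coordField p w y) =
      d% (fun x ↦ g.form x (a x) (coordField p w x)) y (coordField p v y) := by
  have hv := (smoothAt_coordField hy v).mdiffAt
  have hw := (smoothAt_coordField hy w).mdiffAt
  have h := leviCivita_torsionFree g hv hw
  rw [mlieBracket_coordField hy] at h
  rw [leviCivita_metric g ha.mdiffAt hv, leviCivita_metric g ha.mdiffAt hw, hsymm,
    sub_eq_zero.1 h]

/-- **Poincaré lemma**: a vector field with symmetric covariant derivative is locally a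
gradient. -/
lemma exists_potential [FiniteDimensional ℝ E] {W : Set M} (hW : IsOpen W) {p : M} (hp : p ∈ W)
    (hWp : W ⊆ (extChartAt 𝓘(ℝ, E) p).source) (ha : ∀ x ∈ W, SmoothAt a x)
    (hsymm : ∀ x ∈ W, ∀ v w, g.form x (leviCivita g a x v) w = g.form x (leviCivita g a x w) v) :
    ∃ (W' : Set M) (ψ : M → ℝ), IsOpen W' ∧ p ∈ W' ∧ W' ⊆ W ∧ ∀ x ∈ W',
      CMDiffAt ∞ ψ x ∧ ∀ v, d% ψ x v = g.form x (a x) v := by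
  set φ := extChartAt 𝓘(ℝ, E) p with hφ
  set U := φ.target ∩ φ.symm ⁻¹' W with hU
  have hUo : IsOpen U :=
    (continuousOn_extChartAt_symm p).isOpen_inter_preimage (isOpen_extChartAt_target p) hW
  have hpU : φ p ∈ U := ⟨mem_extChartAt_target p, by
    rw [Set.mem_preimage, hφ, extChartAt_to_inv]; exact hp⟩
  -- A ball is convex, as required for the primitive.
  obtain ⟨r, hr, hball⟩ := Metric.isOpen_iff.1 hUo _ hpU
  -- The covector field `a♭` read in the chart.
  let θ : E → E →L[ℝ] ℝ := fun z ↦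
    (g.form (φ.symm z) (a (φ.symm z))).comp (chartDeriv p (φ.symm z)).inverse
  have hθ_apply (v z : E) : θ z v =
    g.form (φ.symm z) (a (φ.symm z)) (coordField p v (φ.symm z)) := rfl
  have hh (v : E) (x) (hx : x ∈ W) : CMDiffAt ∞ (fun x ↦ g.form x (a x) (coordField p v x)) x :=
    (ha x hx).form g (smoothAt_coordField (hWp hx) v)
  have hθ : ContDiffOn ℝ ∞ θ U := by
    rw [contDiffOn_clm_apply]
    intro v z hz
    have h1 : ContMDiffAt 𝓘(ℝ, E) 𝓘(ℝ, E) ∞ φ.symm z :=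
      (contMDiffOn_extChartAt_symm p).contMDiffAt ((isOpen_extChartAt_target p).mem_nhds hz.1)
    exact ((hh v _ hz.2).comp z h1).contDiffAt.contDiffWithinAt
  have hderiv (x) (hx : x ∈ W) (hxU : φ x ∈ U) (v w : E) : fderiv ℝ θ (φ x) w v =
      d% (fun x ↦ g.form x (a x) (coordField p v x)) x (coordField p w x) := by
    have hd := (hθ.contDiffAt (hUo.mem_nhds hxU)).differentiableAt (by simp)
    have h1 := hd.hasFDerivAt.clm_apply (hasFDerivAt_const v (φ x))
    have h2 := mvfderiv_comp_chart (hWp hx) h1.differentiableAt (coordField p w x)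
    rw [h1.fderiv, chartDeriv_coordField (hWp hx)] at h2
    have h3 : (fun x ↦ θ (φ x) v) =ᶠ[𝓝 x] fun x ↦ g.form x (a x) (coordField p v x) := by
      filter_upwards [hW.mem_nhds hx] with y hy
      rw [hθ_apply, φ.left_inv (hWp hy)]
    have h4 := h3.mfderiv_eq (I := 𝓘(ℝ, E)) (I' := 𝓘(ℝ, ℝ))
    have h5 := congr($h4 (coordField p w x))
    refine Eq.trans ?_ (h2.symm.trans h5)
    simp
  obtain ⟨F, hF, hFθ⟩ := exists_primitive_on_convex (convex_ball (φ p) r) Metric.isOpen_ball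
    (hθ.mono hball) fun z hz v w ↦ by
      have hzU := hball hz
      have hx := φ.right_inv hzU.1
      rw [← hx, hderiv _ hzU.2 (by rwa [hx]), hderiv _ hzU.2 (by rwa [hx])]
      exact mvfderiv_form_coordField_comm g (hWp hzU.2) (ha _ hzU.2) (hsymm _ hzU.2) _ _
  have hsub : φ.source ∩ φ ⁻¹' Metric.ball (φ p) r ⊆ W := fun x hx ↦ by
    have := (hball hx.2).2
    rwa [Set.mem_preimage, φ.left_inv hx.1] at this
  refine ⟨φ.source ∩ φ ⁻¹' Metric.ball (φ p) r, fun x ↦ F (φ x),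
    (continuousOn_extChartAt p).isOpen_inter_preimage (isOpen_extChartAt_source p)
      Metric.isOpen_ball, ⟨mem_extChartAt_source p, Metric.mem_ball_self hr⟩, hsub,
    fun x hx ↦ ⟨?_, fun v ↦ ?_⟩⟩
  · exact (hF.contDiffAt (Metric.isOpen_ball.mem_nhds hx.2)).contMDiffAt.comp x
      (contMDiffAt_extChartAt' (by simpa [φ] using hx.1))
  · rw [mvfderiv_comp_chart hx.1 (hFθ _ hx.2).differentiableAt, (hFθ _ hx.2).fderiv, hθ_apply,
      φ.left_inv hx.1, coordField_chartDeriv hx.1]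

end RigidFlow

end

/-! ### From closed acceleration to a Killing field -/

namespace RigidFlow

open Filter Topology

namespace RigidUnitField

variable {A L : Type*} [CommRing A] [AddCommGroup L] [Module A L] [IsAddTorsionFree A]
  (S : RigidUnitField A L)

lemma nab_ε_smul_acc (X : L) : S.nab X (S.ε • S.acc) = S.ε • S.nab X S.acc := by
  rw [S.nab_smul_right, der_ε, zero_smul, add_zero]

/-- The rotation cancels by skewness, so the acceleration alone prevents `u` from being Killing. -/
lemma g_nab_u_add (X Y : L) : S.g (S.nab X S.u) Y + S.g (S.nab Y S.u) X =
    S.g S.u X * S.g (S.ε • S.acc) Y + S.g S.u Y * S.g (S.ε • S.acc) X := by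
  rw [g_nab_u, g_nab_u, F_skew, α, α]
  simp only [map_smul, LinearMap.smul_apply, smul_eq_mul]
  ring

end RigidUnitField

variable {E : Type*} [NormedAddCommGroup E] [NormedSpace ℝ E] [FiniteDimensional ℝ E]
  {M : Type*} [TopologicalSpace M] [ChartedSpace E M] [IsManifold 𝓘(ℝ, E) ∞ M]

section

variable (g : PseudoRiemannianMetric E M) {V : VField E M}

/-- The acceleration of a flow, with lower index `g(u, u) ∇_u u`. -/
noncomputable def accelField (V : VField E M) : VField E M := fun x ↦
  g.form x (unitField g V x) (unitField g V x) • leviCivita g (unitField g V) x (unitField g V x)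

lemma nabFun_restrict {W : TopologicalSpace.Opens M} (X : smoothField (E := E) W) {Z : VField E M}
    (hZ : ∀ x ∈ W, SmoothAt Z x) (x : W) :
    (nabFun g X ⟨fun x : W ↦ Z x, mem_smoothField hZ⟩).1 x = leviCivita g Z x (X.1 x) := by
  rw [nabFun_apply, leviCivita_congr g (mem_smoothField hZ x).mdiffAt (hZ x x.2).mdiffAt
    (extField_eventuallyEq (fun _ ↦ rfl) x)]

lemma leviCivita_smul {f : M → ℝ} {Y : VField E M} {x : M} (hY : MDiffAt (T% Y) x)
    (hf : MDiffAt f x) (v : TangentSpace 𝓘(ℝ, E) x) :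
    leviCivita g (f • Y) x v = f x • leviCivita g Y x v + d% f x v • Y x := by
  have h := (leviCivita g).isCovariantDerivativeOnUniv.leibniz hY hf
  exact congr($h v)

/-- Metric compatibility and torsion-freeness turn the Lie derivative of `g` along `ξ` into the
symmetrization of `∇ξ`. -/
lemma isKillingOn_of_leviCivita {ξ : VField E M} {W : Set M} (hξ : ∀ x ∈ W, SmoothAt ξ x)
    (h : ∀ x ∈ W, ∀ v w, g.form x (leviCivita g ξ x v) w + g.form x (leviCivita g ξ x w) v = 0) :
    IsKillingOn g ξ W := by
  intro x hx X Y hX hY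
  rw [leviCivita_metric g hX.mdiffAt hY.mdiffAt,
    ← leviCivita_torsionFree g (hξ x hx).mdiffAt hX.mdiffAt,
    ← leviCivita_torsionFree g (hξ x hx).mdiffAt hY.mdiffAt]
  simp only [map_sub, sub_apply]
  have := h x hx (X x) (Y x)
  rw [g.symm x _ (X x)] at this
  linarith

lemma SmoothAt.accelField {x : M} (hV : SmoothAt V x) (h : g.form x (V x) (V x) ≠ 0) :
    SmoothAt (accelField g V) x :=
  have hu := hV.unitField g h
  ContMDiffAt.smul_section (hu.form g hu) (hu.covDeriv g hu)

variable {g}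

lemma restrict_nab_u {W : TopologicalSpace.Opens M} {κ : ℝ}
    (hκ : ∀ (x : M) (X Y Z : VField E M), SmoothAt X x → SmoothAt Y x → SmoothAt Z x →
      curvature g X Y Z x = κ • (g.form x (Y x) (Z x) • X x - g.form x (X x) (Z x) • Y x))
    (hV : ∀ x, SmoothAt V x) (hnn : IsNonNull g V) (hrigid : IsBornRigid g V)
    (X : smoothField (E := E) W) (x : W) :
    ((rigidUnitField W hκ hV hnn hrigid).nab X (rigidUnitField W hκ hV hnn hrigid).u).1 x =
      leviCivita g (unitField g V) x (X.1 x) :=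
  nabFun_restrict g X (fun x _ ↦ (hV x).unitField g (hnn x)) x

lemma restrict_ε_smul_acc {W : TopologicalSpace.Opens M} {κ : ℝ}
    (hκ : ∀ (x : M) (X Y Z : VField E M), SmoothAt X x → SmoothAt Y x → SmoothAt Z x →
      curvature g X Y Z x = κ • (g.form x (Y x) (Z x) • X x - g.form x (X x) (Z x) • Y x))
    (hV : ∀ x, SmoothAt V x) (hnn : IsNonNull g V) (hrigid : IsBornRigid g V) :
    (rigidUnitField W hκ hV hnn hrigid).ε • (rigidUnitField W hκ hV hnn hrigid).acc =
      ⟨fun x : W ↦ accelField g V x, mem_smoothField fun x _ ↦ (hV x).accelField g (hnn x)⟩ := by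
  ext x
  change (formL g W _ _).1 x • _ = accelField g V x
  rw [formL_apply]
  exact congrArg _ (restrict_nab_u hκ hV hnn hrigid _ x)

/-- The equations of a rigid flow which is rotating on `W`. -/
lemma rotating_rigid_flow {W : TopologicalSpace.Opens M} (hg : HasConstantCurvature g)
    (hV : ∀ x, SmoothAt V x) (hnn : IsNonNull g V) (hrigid : IsBornRigid g V)
    {X₀ Y₀ : VField E M} (hX₀ : ∀ x ∈ W, SmoothAt X₀ x) (hY₀ : ∀ x ∈ W, SmoothAt Y₀ x)
    (hVX₀ : ∀ x ∈ W, g.form x (V x) (X₀ x) = 0) (hVY₀ : ∀ x ∈ W, g.form x (V x) (Y₀ x) = 0)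
    (hrot : ∀ x ∈ W, g.form x (leviCivita g (unitField g V) x (X₀ x)) (Y₀ x) ≠ 0)
    {X Y : VField E M} (hX : ∀ x ∈ W, SmoothAt X x) (hY : ∀ x ∈ W, SmoothAt Y x)
    {x : M} (hx : x ∈ W) :
    g.form x (leviCivita g (accelField g V) x (X x)) (Y x) =
        g.form x (leviCivita g (accelField g V) x (Y x)) (X x) ∧
      g.form x (leviCivita g (unitField g V) x (X x)) (Y x) +
          g.form x (leviCivita g (unitField g V) x (Y x)) (X x) =
        g.form x (unitField g V x) (X x) * g.form x (accelField g V x) (Y x) +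
          g.form x (unitField g V x) (Y x) * g.form x (accelField g V x) (X x) := by
  obtain ⟨κ, hκ⟩ := hg
  let S := rigidUnitField W hκ hV hnn hrigid
  let r {Z : VField E M} (hZ : ∀ x ∈ W, SmoothAt Z x) : smoothField (E := E) W :=
    ⟨fun x : W ↦ Z x, mem_smoothField hZ⟩
  have hu (Z : VField E M) (hZ : ∀ x ∈ W, SmoothAt Z x) (h : ∀ x ∈ W, g.form x (V x) (Z x) = 0) :
      S.g S.u (r hZ) = 0 := by
    ext x
    change (formL g W _ _).1 x = 0
    rw [formL_apply]
    change g.form x ((√|g.form x (V x) (V x)|)⁻¹ • V x) (Z x) = 0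
    rw [map_smul, smul_apply, h x x.2, smul_zero]
  have hu₀ := hu X₀ hX₀ hVX₀
  -- A nowhere vanishing function is not a zero divisor.
  have hreg (a : smoothFun E W) (ha : S.F (r hX₀) (r hY₀) * a = 0) : a = 0 := by
    ext y
    have h := congrFun (congrArg Subtype.val ha) y
    change (S.F (r hX₀) (r hY₀)).1 y * a.1 y = 0 at h
    refine (mul_eq_zero.1 h).resolve_left ?_
    rw [RigidUnitField.F, ← S.nab_u_spatial hu₀]
    change (formL g W _ _).1 y ≠ 0
    rw [formL_apply, restrict_nab_u]
    exact hrot y y.2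
  have hC := S.C_symm hu₀ (hu Y₀ hY₀ hVY₀) hreg (r hX) (r hY)
  have hacc := restrict_ε_smul_acc (W := W) hκ hV hnn hrigid
  constructor
  · have h (X Y : VField E M) (hX : ∀ x ∈ W, SmoothAt X x) (hY : ∀ x ∈ W, SmoothAt Y x) :
        (S.ε * S.C (r hX) (r hY)).1 ⟨x, hx⟩ =
          g.form x (leviCivita g (accelField g V) x (X x)) (Y x) := by
      have h1 : S.ε * S.C (r hX) (r hY) = S.g (S.nab (r hX) (S.ε • S.acc)) (r hY) := by
        rw [S.nab_ε_smul_acc, map_smul]; rfl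
      rw [h1, hacc]
      change (formL g W _ _).1 ⟨x, hx⟩ = _
      rw [formL_apply]
      exact congrArg (fun v ↦ g.form x v (Y x))
        (nabFun_restrict g (r hX) (fun x _ ↦ (hV x).accelField g (hnn x)) ⟨x, hx⟩)
    rw [← h X Y hX hY, ← h Y X hY hX, hC]
  · have h := congrFun (congrArg Subtype.val (S.g_nab_u_add (r hX) (r hY))) ⟨x, hx⟩
    rw [hacc] at h
    change (formL g W _ _).1 _ + (formL g W _ _).1 _ =
      (formL g W _ _).1 _ * (formL g W _ _).1 _ + (formL g W _ _).1 _ * (formL g W _ _).1 _ at h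
    simp only [formL_apply] at h
    rw [restrict_nab_u, restrict_nab_u] at h
    exact h

/-- A rigid flow for which `g(u, u) ∇_u u` is a gradient is isometric. -/
lemma isKillingOn_exp_potential {W : Set M} {ψ : M → ℝ}
    (hV : ∀ x, SmoothAt V x) (hnn : IsNonNull g V)
    (hψ : ∀ x ∈ W, CMDiffAt ∞ ψ x ∧ ∀ v, d% ψ x v = g.form x (accelField g V x) v)
    (hu : ∀ x ∈ W, ∀ v w, g.form x (leviCivita g (unitField g V) x v) w +
          g.form x (leviCivita g (unitField g V) x w) v =
        g.form x (unitField g V x) v * g.form x (accelField g V x) w +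
          g.form x (unitField g V x) w * g.form x (accelField g V x) v) :
    IsKillingOn g ((fun x ↦ Real.exp (-ψ x)) • unitField g V) W := by
  have hh (x) (hx : x ∈ W) : CMDiffAt ∞ (fun x ↦ Real.exp (-ψ x)) x :=
    (Real.contDiff_exp.comp contDiff_neg).contDiffAt.contMDiffAt.comp x (hψ x hx).1
  have hder (x) (hx : x ∈ W) (v) : d% (fun x ↦ Real.exp (-ψ x)) x v =
      -(Real.exp (-ψ x) * g.form x (accelField g V x) v) := by
    have h1 : HasDerivAt (fun t : ℝ ↦ Real.exp (-t)) (-Real.exp (-ψ x)) (ψ x) := by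
      simpa using (hasDerivAt_neg (ψ x)).exp
    have h2 := mfderiv_comp (I := 𝓘(ℝ, E)) (I' := 𝓘(ℝ, ℝ)) (I'' := 𝓘(ℝ, ℝ)) x
      h1.differentiableAt.mdifferentiableAt ((hψ x hx).1.mdifferentiableAt (by simp))
    rw [mfderiv_eq_fderiv, h1.hasFDerivAt.fderiv] at h2
    have h3 := congr($h2 v)
    rw [← (hψ x hx).2]
    refine h3.trans ?_
    change mvfderiv 𝓘(ℝ, E) ψ x v • -Real.exp (-ψ x) = _
    rw [smul_eq_mul]
    ring
  refine isKillingOn_of_leviCivita g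
    (fun x hx ↦ ContMDiffAt.smul_section (hh x hx) ((hV x).unitField g (hnn x)))
    fun x hx v w ↦ ?_
  have hum := ((hV x).unitField g (hnn x)).mdiffAt
  have hhm := (hh x hx).mdifferentiableAt (by simp)
  rw [leviCivita_smul g hum hhm, leviCivita_smul g hum hhm, hder x hx, hder x hx]
  simp only [map_add, map_smul, add_apply, smul_apply, smul_eq_mul]
  -- The terms from `d(exp(-ψ))` are minus `exp(-ψ)` times the right side of `hu`.
  linear_combination Real.exp (-ψ x) * hu x hx v w

end

section

variable {g : PseudoRiemannianMetric E M} {V : VField E M}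

/-- In constant curvature, a rigid flow is isometric near every point at which it is rotating. -/
theorem IsRotatingAt.isIsometricNear {p : M} (hp : IsRotatingAt g V p)
    (hg : HasConstantCurvature g) (hV : ∀ x, SmoothAt V x) (hnn : IsNonNull g V)
    (hrigid : IsBornRigid g V) : IsIsometricNear g V p := by
  have : CompleteSpace E := FiniteDimensional.complete ℝ E
  obtain ⟨a, b, hab⟩ := hp.exists_kinematic_ne_zero
  -- A smooth field orthogonal to `V` whose value at `p` is the projection of `v`: a coordinate
  -- field projected pointwise.
  let X (v : TangentSpace 𝓘(ℝ, E) p) : VField E M := fun y ↦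
    proj g V y (coordField p (chartDeriv p p v) y)
  have hX {y : M} (hy : y ∈ (extChartAt 𝓘(ℝ, E) p).source) (v) : SmoothAt (X v) y :=
    (smoothAt_coordField hy _).proj g (hV y) (hnn y)
  let h : M → ℝ := fun y ↦ g.form y (leviCivita g (unitField g V) y (X b y)) (X a y)
  have hh : ContinuousOn h (extChartAt 𝓘(ℝ, E) p).source := fun y hy ↦
    (((hX hy b).covDeriv g ((hV y).unitField g (hnn y))).form g
      (hX hy a)).continuousAt.continuousWithinAt
  have hps := mem_extChartAt_source (I := 𝓘(ℝ, E)) p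
  -- On this open set the rotation of the pair `X b`, `X a` vanishes nowhere; it contains `p` by the
  -- choice of `a`, `b`.
  have hWo := hh.isOpen_inter_preimage (isOpen_extChartAt_source p) isOpen_ne (t := {t | t ≠ 0})
  let W : TopologicalSpace.Opens M := ⟨_, hWo⟩
  have hpW : p ∈ W := ⟨hps, by
    rw [kinematic_eq, g.symm] at hab
    simpa only [h, X, coordField_chartDeriv hps, Set.mem_preimage, Set.mem_ofPred_eq] using hab⟩
  -- The equations hold for fields; tangent vectors at `x` are reached by extending them to
  -- coordinate fields of the chart at `p`.
  have key {x : M} (hx : x ∈ W) (v w : TangentSpace 𝓘(ℝ, E) x) :=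
    rotating_rigid_flow (W := W) hg hV hnn hrigid (fun x hx ↦ hX hx.1 b) (fun x hx ↦ hX hx.1 a)
      (fun x _ ↦ form_proj g (hnn x) _) (fun x _ ↦ form_proj g (hnn x) _) (fun x hx ↦ hx.2)
      (fun x hx ↦ smoothAt_coordField hx.1 (chartDeriv p _ v))
      (fun x hx ↦ smoothAt_coordField hx.1 (chartDeriv p _ w)) hx
  obtain ⟨W', ψ, hW', hpW', hsub, hψ⟩ := exists_potential g hWo hpW (fun x hx ↦ hx.1)
    (fun x _ ↦ (hV x).accelField g (hnn x)) fun x hx v w ↦ by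
      simpa only [coordField_chartDeriv hx.1] using (key hx v w).1
  have hK := isKillingOn_exp_potential hV hnn hψ fun x hx v w ↦ by
    simpa only [coordField_chartDeriv (hsub hx).1] using (key (hsub hx) v w).2
  -- The second factor is the normalization of `V`, so `f V = exp(-ψ) u`.
  refine ⟨W', fun x ↦ Real.exp (-ψ x) * (√|g.form x (V x) (V x)|)⁻¹, hW', hpW',
    fun x _ ↦ mul_pos (Real.exp_pos _)
      (inv_pos.2 (Real.sqrt_pos.2 (abs_pos.2 (hnn x)))), fun x hx ↦ ?_, ?_⟩
  · exact (((Real.contDiff_exp.comp contDiff_neg).contDiffAt.contMDiffAt.comp x (hψ x hx).1).mul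
      (contMDiffAt_inv_sqrt_abs ((hV x).form g (hV x)) (hnn x))).contMDiffWithinAt
  · simp only [mul_smul]
    exact hK

end

end RigidFlow

theorem mainTheorem1
    {E : Type*} [NormedAddCommGroup E] [NormedSpace ℝ E] [FiniteDimensional ℝ E]
    {M : Type*} [TopologicalSpace M] [ChartedSpace E M] [IsManifold 𝓘(ℝ, E) ∞ M]
    (g : RigidFlow.PseudoRiemannianMetric E M) (hg : RigidFlow.HasConstantCurvature g)
    (V : RigidFlow.VField E M) (hV : ∀ x, RigidFlow.SmoothAt V x)
    (hnn : RigidFlow.IsNonNull g V) (hrigid : RigidFlow.IsBornRigid g V) :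
    ∀ p, RigidFlow.IsRotatingAt g V p → RigidFlow.IsIsometricNear g V p :=
  fun _ hp ↦ hp.isIsometricNear hg hV hnn hrigid
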